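/- Let $\kappa\ge 2$ be an integer and let $Q(f)=-f^{\kappa}+\sum_{\alpha=0}^{\kappa-1}a_\alpha f^{\alpha}$ be a real polynomial with $\kappa$ simple real roots $q^{\kappa}<q^{\kappa-1}<\cdots<q^{1}$. (The superscripts of $q$, $p$, $T$, $h$, $\mathcal H$ are indices.) Consider the planar system $x'(s)=iQ(x(s))$, $x\in\mathbb C$, on the Poincaré hemisphere $\mathbb H^2=\{(U,w)\in\mathbb C\times\mathbb R: |U|^2+w^2=1,\ w\ge 0\}$, where $x\in\mathbb C$ corresponds to $(U,w)=(x,1)/\sqrt{1+|x|^2}$ and the equator $w=0$ represents $x=\infty$. For $j\in\{1,\ldots,\kappa-1\}$ let $h^j=(e^{i\theta_j},0)$ with $\theta_j=\frac{\pi}{\kappa-1}(j-1)+\frac{\pi}{2(\kappa-1)}$, a saddle on the equator, and let $\mathcal H^j\subset\mathbb C$ be its stable manifold if $j$ is odd and its unstable manifold if $j$ is even, without $h^j$; that is, $\mathcal H^j$ is the set of those $z\in\mathbb C$ whose trajectory converges on $\mathbb H^2$ to $h^j$ in forward time ($j$ odd), respectively backward time ($j$ even). Then $$\sum_{l=1}^{\kappa}\frac{1}{Q'(q^l)}=0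 .$$ Moreover, for every $j\in\{1,\ldots,\kappa-1\}$, $\mathcal H^j$ meets the real axis in exactly one point $p^j$, the solution of $x'(s)=iQ(x(s))$, $x(0)=p^j$, $s\ge 0$, blows up at a finite time $T^j\in(0,\infty)$ (i.e. it exists on $[0,T^j)$ and $|x(s)|\to\infty$ as $s\to T^j$ from below), and $$\sum_{l=1}^{j}\frac{1}{Q'(q^l)}=\frac{(-1)^j\,T^j}{\pi}.$$ -/

import Mathlib

open Polynomial Filter Topology

noncomputable section

/-- The real polynomial `Q(f) = -f^κ + ∑_{α < κ} a_α f^α`. -/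
def polyQ (κ : ℕ) (a : ℕ → ℝ) : ℝ[X] :=
  -X ^ κ + ∑ α ∈ Finset.range κ, C (a α) * X ^ α

/-- The numbers `q 1 > q 2 > ⋯ > q κ` are simple real roots of `Q`. -/
structure HasOrderedSimpleRoots (κ : ℕ) (Q : ℝ[X]) (q : ℕ → ℝ) : Prop where
  anti : StrictAntiOn q (Set.Icc 1 κ)
  root : ∀ j ∈ Set.Icc 1 κ, Q.eval (q j) = 0
  simple : ∀ j ∈ Set.Icc 1 κ, Q.derivative.eval (q j) ≠ 0

/-- The vector field `x ↦ i Q(x)` on `ℂ`. -/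
def imagField (Q : ℝ[X]) (x : ℂ) : ℂ := Complex.I * aeval x Q

/-- The time interval `[0, ω)`, where `ω` may be `∞`. -/
def forwardInterval (ω : EReal) : Set ℝ := {s | 0 ≤ s ∧ (s : EReal) < ω}

/-- `x` solves `x' = f(x)`, `x(0) = z`, on `[0, ω)` with `0 < ω ≤ ∞`. -/
structure IsForwardSolution (f : ℂ → ℂ) (z : ℂ) (ω : EReal) (x : ℝ → ℂ) : Prop where
  pos : 0 < ω
  init : x 0 = z
  deriv : ∀ s ∈ forwardInterval ω, HasDerivWithinAt x (f (x s)) (forwardInterval ω) s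

/-- The embedding of the plane `ℂ` as the open upper hemisphere of the unit sphere in
`ℂ × ℝ = ℝ³`: the point `(U, w)` with `|U|² + w² = 1`, `w > 0` and `x = U / w`. -/
def poincareEmbedding (x : ℂ) : ℂ × ℝ :=
  ((((Real.sqrt (1 + ‖x‖ ^ 2))⁻¹ : ℝ) : ℂ) * x, (Real.sqrt (1 + ‖x‖ ^ 2))⁻¹)

/-- The point of the equator (the circle at infinity) with angle
`(π / (κ - 1)) (l - 1) + π / (2 (κ - 1))`. -/
def equatorSaddle (κ l : ℕ) : ℂ × ℝ :=
  (Complex.exp (Complex.I *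
    ((Real.pi / ((κ : ℝ) - 1) * ((l : ℝ) - 1) + Real.pi / (2 * ((κ : ℝ) - 1)) : ℝ) : ℂ)), 0)

/-- The finite part of the stable manifold of a point `h` of the closed hemisphere: all `z ∈ ℂ`
whose forward trajectory under `x' = f(x)`, seen on the hemisphere, converges to `h`. The
trajectory is followed in the original time, up to a time `ω` which may be finite or infinite
(the notion only depends on orbits, hence not on the way time is parametrised). -/
def stableManifold (f : ℂ → ℂ) (h : ℂ × ℝ) : Set ℂ :=
  {z | ∃ (ω : EReal) (x : ℝ → ℂ), IsForwardSolution f z ω x ∧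
    Tendsto (fun s => poincareEmbedding (x s))
      (comap (fun s : ℝ => (s : EReal)) (𝓝[<] ω)) (𝓝 h)}

/-- The finite part of the unstable manifold: the stable manifold for reversed time. -/
def unstableManifold (f : ℂ → ℂ) (h : ℂ × ℝ) : Set ℂ :=
  stableManifold (fun x => -f x) h

/-- The trajectory `ℋ^j` of `x' = i Q(x)`: the stable (`j` odd) or unstable (`j` even) manifold
of the equilibrium `equatorSaddle κ j` at infinity, without the equilibrium itself. -/
def trajH (κ : ℕ) (Q : ℝ[X]) (j : ℕ) : Set ℂ :=
  if Odd j then stableManifold (imagField Q) (equatorSaddle κ j)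
  else unstableManifold (imagField Q) (equatorSaddle κ j)

/-- The solution of `x' = f(x)`, `x(0) = z`, `s ≥ 0`, blows up at the finite time `T`. -/
def IsBlowupTime (f : ℂ → ℂ) (z : ℂ) (T : ℝ) : Prop :=
  ∃ x : ℝ → ℂ, IsForwardSolution f z (T : EReal) x ∧
    Tendsto (fun s => ‖x s‖) (𝓝[<] T) atTop

end

/-!
The partial fraction decomposition of `1 / Q` gives a primitive `F` of `1 / Q` on the closed upper
half plane, with logarithmic singularities at the roots. Along solutions of `x' = iQ(x)` one has
`(F ∘ x)' = i`, so trajectories are level curves of `Re F`, and `F → 0` at infinity because the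
residues of `1 / Q` add up to `0`. Between two consecutive roots `Q` and the jumps
`π ∑_{l ≤ j} 1 / Q'(q l)` of `Im F` have opposite signs, and this propagates to `Im (Q F) < 0` on
the upper half plane: for fixed `x`, `Im (Q(x) F(x))` is a divided difference of a function of the
root, up to a polynomial annihilated by it. Hence `(log F)' = 1 / (Q F)` has positive imaginary
part, and by the Noshiro–Warschawski argument every level curve of `Im (log F)` is a graph over the
imaginary axis along which `|F|` decreases. The level curve through the zero `p` of `Re F` between
`q (j + 1)` and `q j` runs from `F = ±iT`, with `T = π |∑_{l ≤ j} 1 / Q'(q l)|`, to `F = 0`; being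
traversed with unit speed in `F`, it is the trajectory from `p` and reaches infinity at time `T`.
-/

noncomputable section

/-! ### Divided differences -/

section DividedDifference

variable {ι F : Type*} [DecidableEq ι] [Field F] {s : Finset ι} {v : ι → F}

/-- The divided difference of the values `f` at the nodes `v l`, `l ∈ s`, in Lagrange form. -/
def dividedDifference (s : Finset ι) (v f : ι → F) : F :=
  ∑ l ∈ s, f l * Lagrange.nodalWeight s v l

theorem nodalWeight_insert_of_mem {i l : ι} (hi : i ∉ s) (hl : l ∈ s) :
    Lagrange.nodalWeight (insert i s) v l = (v l - v i)⁻¹ * Lagrange.nodalWeight s v l := by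
  have herase : (insert i s).erase l = insert i (s.erase l) :=
    Finset.erase_insert_of_ne fun h => hi (h ▸ hl)
  rw [Lagrange.nodalWeight, herase, Finset.prod_insert fun h => hi (Finset.mem_of_mem_erase h),
    Lagrange.nodalWeight]

theorem nodalWeight_insert_self {i : ι} (hi : i ∉ s) :
    Lagrange.nodalWeight (insert i s) v i = ∏ k ∈ s, (v i - v k)⁻¹ := by
  rw [Lagrange.nodalWeight, Finset.erase_insert hi]

theorem dividedDifference_insert_insert {i j : ι} (hi : i ∉ s) (hj : j ∉ s) (hij : i ≠ j)
    (hv : Set.InjOn v (insert i (insert j s) : Finset ι)) (f : ι → F) :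
    (v i - v j) * dividedDifference (insert i (insert j s)) v f
      = dividedDifference (insert i s) v f - dividedDifference (insert j s) v f := by
  have hi' : i ∉ insert j s := by simp [hij, hi]
  have hvij : v i - v j ≠ 0 := sub_ne_zero.2 fun h => hij (hv (by simp) (by simp) h)
  have hvji : v j - v i ≠ 0 := by rwa [← neg_sub, neg_ne_zero]
  have weight_i : (v i - v j) * (f i * Lagrange.nodalWeight (insert i (insert j s)) v i)
      = f i * Lagrange.nodalWeight (insert i s) v i := by
    rw [nodalWeight_insert_self hi', Finset.prod_insert hj, nodalWeight_insert_self hi]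
    field_simp
  have weight_j : (v i - v j) * (f j * Lagrange.nodalWeight (insert i (insert j s)) v j)
      = -(f j * Lagrange.nodalWeight (insert j s) v j) := by
    rw [nodalWeight_insert_of_mem hi' (by simp), ← neg_sub (v j) (v i)]
    field_simp
  have weight_rest : ∀ l ∈ s, (v i - v j) *
      (f l * Lagrange.nodalWeight (insert i (insert j s)) v l)
      = f l * Lagrange.nodalWeight (insert i s) v l
        - f l * Lagrange.nodalWeight (insert j s) v l := by
    intro l hl
    rw [nodalWeight_insert_of_mem hi' (by simp [hl]), nodalWeight_insert_of_mem hj hl,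
      nodalWeight_insert_of_mem hi hl]
    have hli : v l - v i ≠ 0 := sub_ne_zero.2 fun h => hi (hv (by simp [hl]) (by simp) h ▸ hl)
    have hlj : v l - v j ≠ 0 := sub_ne_zero.2 fun h => hj (hv (by simp [hl]) (by simp) h ▸ hl)
    field_simp
    ring
  simp only [dividedDifference]
  rw [Finset.sum_insert hi', Finset.sum_insert hj, Finset.sum_insert hi, Finset.sum_insert hj,
    mul_add, mul_add, Finset.mul_sum, Finset.sum_congr rfl weight_rest, Finset.sum_sub_distrib,
    weight_i, weight_j]
  ring

theorem dividedDifference_eval (hv : Set.InjOn v s) {P : F[X]} (hP : P.degree < s.card) :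
    dividedDifference s v (fun l => P.eval (v l)) = P.coeff (s.card - 1) := by
  rw [Lagrange.coeff_eq_sum hv hP]
  refine Finset.sum_congr rfl fun l _ => ?_
  rw [Lagrange.nodalWeight, Finset.prod_inv_distrib, div_eq_mul_inv]

theorem dividedDifference_const_one (hv : Set.InjOn v s) (hs : 1 < s.card) :
    dividedDifference s v (fun _ => 1) = 0 := by
  have hdeg : (1 : F[X]).degree < s.card := by
    rw [degree_one]
    exact_mod_cast zero_lt_one.trans hs
  have h := dividedDifference_eval hv hdeg
  simp only [eval_one] at h
  rw [h, coeff_one, if_neg (by omega)]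

theorem dividedDifference_Icc_succ {q : ℕ → F} {a n : ℕ}
    (hq : Set.InjOn q (Set.Icc a (a + (n + 1)))) (f : ℕ → F) :
    (q a - q (a + (n + 1))) * dividedDifference (Finset.Icc a (a + (n + 1))) q f
      = dividedDifference (Finset.Icc a (a + n)) q f
        - dividedDifference (Finset.Icc (a + 1) (a + 1 + n)) q f := by
  have hfull : Finset.Icc a (a + (n + 1))
      = insert a (insert (a + (n + 1)) (Finset.Icc (a + 1) (a + n))) := by
    ext l; simp only [Finset.mem_insert, Finset.mem_Icc]; omega
  have hinit : Finset.Icc a (a + n) = insert a (Finset.Icc (a + 1) (a + n)) := by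
    ext l; simp only [Finset.mem_insert, Finset.mem_Icc]; omega
  have htail : Finset.Icc (a + 1) (a + 1 + n)
      = insert (a + (n + 1)) (Finset.Icc (a + 1) (a + n)) := by
    ext l; simp only [Finset.mem_insert, Finset.mem_Icc]; omega
  rw [hfull, hinit, htail]
  refine dividedDifference_insert_insert (by simp) (by simp) (by omega) ?_ f
  rw [← hfull]
  simpa using hq

end DividedDifference

section StepFunction

/-- The divided difference over the nodes `q a, …, q (a + n)` of the step function that is `1` up
to the index `m` and `0` afterwards. -/
def stepDiff (q : ℕ → ℝ) (a n m : ℕ) : ℝ :=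
  dividedDifference (Finset.Icc a (a + n)) q fun l => if l ≤ m then 1 else 0

variable {q : ℕ → ℝ} {a n m : ℕ}

theorem stepDiff_eq_sum (h : m ≤ a + n) : stepDiff q a n m
    = ∑ l ∈ Finset.Icc a m, Lagrange.nodalWeight (Finset.Icc a (a + n)) q l := by
  simp only [stepDiff, dividedDifference, ite_mul, one_mul, zero_mul]
  rw [← Finset.sum_filter]
  congr 1
  ext l
  simp only [Finset.mem_filter, Finset.mem_Icc]
  omega

theorem stepDiff_of_lt (h : m < a) : stepDiff q a n m = 0 := by
  rw [stepDiff_eq_sum (by omega), Finset.Icc_eq_empty (by omega), Finset.sum_empty]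

theorem stepDiff_zero_self : stepDiff q a 0 a = 1 := by
  simp [stepDiff, dividedDifference, Lagrange.nodalWeight]

theorem stepDiff_of_le (hq : Set.InjOn q (Set.Icc a (a + n))) (hn : 1 ≤ n) (h : a + n ≤ m) :
    stepDiff q a n m = 0 := by
  have hone : dividedDifference (Finset.Icc a (a + n)) q (fun _ => 1) = 0 :=
    dividedDifference_const_one (by simpa using hq) (by rw [Nat.card_Icc]; omega)
  rw [← hone, stepDiff, dividedDifference, dividedDifference]
  exact Finset.sum_congr rfl fun l hl => by rw [if_pos ((Finset.mem_Icc.1 hl).2.trans h)]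

theorem stepDiff_succ (hq : Set.InjOn q (Set.Icc a (a + (n + 1)))) :
    (q a - q (a + (n + 1))) * stepDiff q a (n + 1) m
      = stepDiff q a n m - stepDiff q (a + 1) n m :=
  dividedDifference_Icc_succ hq _

theorem stepDiff_pos (n : ℕ) : ∀ a m : ℕ, StrictAntiOn q (Set.Icc a (a + (n + 1))) →
    a ≤ m → m ≤ a + n → 0 < (-1) ^ (m + a) * stepDiff q a (n + 1) m := by
  induction n with
  | zero =>
    intro a m hq ham hma
    obtain rfl : m = a := by omega
    have hrec := stepDiff_succ (m := m) hq.injOn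
    rw [stepDiff_zero_self, stepDiff_of_lt (Nat.lt_succ_self m), sub_zero] at hrec
    have hgap : 0 < q m - q (m + (0 + 1)) := sub_pos.2 (hq (by simp) (by simp) (by omega))
    rw [← two_mul, pow_mul, neg_one_sq, one_pow, one_mul]
    exact pos_of_mul_pos_right (hrec ▸ one_pos) hgap.le
  | succ n ih =>
    intro a m hq ham hma
    have hgap : 0 < q a - q (a + (n + 1 + 1)) := sub_pos.2 (hq (by simp) (by simp) (by omega))
    have hinit : StrictAntiOn q (Set.Icc a (a + (n + 1))) :=
      hq.mono (Set.Icc_subset_Icc_right (by omega))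
    have htail : StrictAntiOn q (Set.Icc (a + 1) (a + 1 + (n + 1))) :=
      hq.mono (Set.Icc_subset_Icc (by omega) (by omega))
    have hrec : (q a - q (a + (n + 1 + 1))) * ((-1) ^ (m + a) * stepDiff q a (n + 1 + 1) m)
        = (-1) ^ (m + a) * stepDiff q a (n + 1) m
          + (-1) ^ (m + (a + 1)) * stepDiff q (a + 1) (n + 1) m := by
      linear_combination (-1 : ℝ) ^ (m + a) * stepDiff_succ (m := m) hq.injOn
    refine pos_of_mul_pos_right (hrec ▸ ?_) hgap.le
    rcases ham.eq_or_lt with rfl | ham'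
    · rw [stepDiff_of_lt (a := a + 1) (Nat.lt_succ_self a), mul_zero, add_zero]
      exact ih _ _ hinit le_rfl (by omega)
    rcases hma.eq_or_lt with rfl | hma'
    · rw [stepDiff_of_le hinit.injOn (by omega) le_rfl, mul_zero, zero_add]
      exact ih _ _ htail ham' (by omega)
    · exact add_pos (ih _ _ hinit ham (by omega)) (ih _ _ htail ham' (by omega))

end StepFunction

/-! ### The residues of the reciprocal polynomial -/

theorem neg_one_pow_card_mul_prod_pos {ι R : Type*} [CommRing R] [LinearOrder R]
    [IsStrictOrderedRing R] {s : Finset ι} {f : ι → R} (hf : ∀ i ∈ s, f i ≠ 0) :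
    0 < (-1) ^ (s.filter (f · < 0)).card * ∏ i ∈ s, f i := by
  rw [← Finset.prod_const, Finset.prod_filter, ← Finset.prod_mul_distrib]
  refine Finset.prod_pos fun i hi => ?_
  split_ifs with hneg
  · rw [neg_one_mul]
    exact neg_pos.2 hneg
  · rw [one_mul]
    exact lt_of_le_of_ne (not_lt.1 hneg) (hf i hi).symm

/-- The residue of `1 / Q` at `q l`, where `Q = -∏ (X - q l)`. -/
def residueAt (κ : ℕ) (q : ℕ → ℝ) (l : ℕ) : ℝ :=
  -Lagrange.nodalWeight (Finset.Icc 1 κ) q l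

/-- The sum of the residues of `1 / Q` at the `m` largest roots. -/
def residueSum (κ : ℕ) (q : ℕ → ℝ) (m : ℕ) : ℝ := ∑ l ∈ Finset.Icc 1 m, residueAt κ q l

section Residues

variable {κ : ℕ} {q : ℕ → ℝ}

theorem injOn_ofReal_comp (hq : StrictAntiOn q (Set.Icc 1 κ)) :
    Set.InjOn (fun l => (q l : ℂ)) (Finset.Icc 1 κ : Finset ℕ) := by
  rw [Finset.coe_Icc]
  exact Complex.ofReal_injective.comp_injOn hq.injOn

theorem ofReal_residueAt (l : ℕ) : (residueAt κ q l : ℂ)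
    = -Lagrange.nodalWeight (Finset.Icc 1 κ) (fun l => (q l : ℂ)) l := by
  simp [residueAt, Lagrange.nodalWeight]

theorem sum_residueAt_mul_eval (hq : StrictAntiOn q (Set.Icc 1 κ)) {P : ℂ[X]}
    (hP : P.degree < (κ : WithBot ℕ)) :
    ∑ l ∈ Finset.Icc 1 κ, (residueAt κ q l : ℂ) * P.eval (q l : ℂ) = -P.coeff (κ - 1) := by
  have h := dividedDifference_eval (injOn_ofReal_comp hq) (P := P) (by simpa using hP)
  rw [Nat.card_Icc, Nat.add_sub_cancel] at h
  rw [← h, dividedDifference, ← Finset.sum_neg_distrib]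
  exact Finset.sum_congr rfl fun l _ => by rw [ofReal_residueAt]; ring

theorem residueSum_eq_neg_stepDiff {n m : ℕ} (h : m ≤ 1 + n) :
    residueSum (1 + n) q m = -stepDiff q 1 n m := by
  rw [stepDiff_eq_sum h, residueSum, ← Finset.sum_neg_distrib]
  rfl

theorem residueSum_self (hκ : 2 ≤ κ) (hq : StrictAntiOn q (Set.Icc 1 κ)) :
    residueSum κ q κ = 0 := by
  obtain ⟨n, rfl⟩ := Nat.exists_eq_add_of_le (one_le_two.trans hκ)
  rw [residueSum_eq_neg_stepDiff le_rfl, stepDiff_of_le hq.injOn (by omega) le_rfl, neg_zero]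

theorem residueSum_pos (hq : StrictAntiOn q (Set.Icc 1 κ)) {m : ℕ} (hlo : 1 ≤ m) (hhi : m < κ) :
    0 < (-1) ^ m * residueSum κ q m := by
  obtain ⟨n, rfl⟩ : ∃ n, κ = 1 + (n + 1) := ⟨κ - 2, by omega⟩
  have h := stepDiff_pos n 1 m hq hlo (by omega)
  rw [residueSum_eq_neg_stepDiff hhi.le]
  linear_combination h

theorem residueAt_pos (hq : StrictAntiOn q (Set.Icc 1 κ)) {l : ℕ} (hlo : 1 ≤ l) (hhi : l ≤ κ) :
    0 < (-1) ^ l * residueAt κ q l := by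
  have hlt : ∀ k ∈ (Finset.Icc 1 κ).erase l, (q l - q k)⁻¹ < 0 ↔ k < l := fun k hk => by
    rw [Finset.mem_erase, Finset.mem_Icc] at hk
    rw [inv_lt_zero, sub_neg, hq.lt_iff_gt ⟨hlo, hhi⟩ hk.2]
  have hcard : (((Finset.Icc 1 κ).erase l).filter fun k => (q l - q k)⁻¹ < 0).card = l - 1 := by
    rw [Finset.filter_congr hlt, ← Nat.card_Ico]
    congr 1
    ext k
    simp only [Finset.mem_filter, Finset.mem_erase, Finset.mem_Icc, Finset.mem_Ico]
    omega
  have hpos := neg_one_pow_card_mul_prod_pos (s := (Finset.Icc 1 κ).erase l)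
    (f := fun k => (q l - q k)⁻¹) fun k hk => by
      rw [Finset.mem_erase, Finset.mem_Icc] at hk
      exact inv_ne_zero (sub_ne_zero.2 fun h => hk.1 (hq.injOn hk.2 ⟨hlo, hhi⟩ h.symm))
  rw [hcard] at hpos
  obtain ⟨n, rfl⟩ := Nat.exists_eq_add_of_le' hlo
  rw [Nat.add_sub_cancel] at hpos
  rw [residueAt, Lagrange.nodalWeight]
  linear_combination hpos

theorem sum_residueAt_mul_neg (hκ : 2 ≤ κ) (hq : StrictAntiOn q (Set.Icc 1 κ)) {f : ℕ → ℝ}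
    (hf : ∀ m, 1 ≤ m → m < κ → 0 < (-1) ^ m * (f (m + 1) - f m)) :
    ∑ l ∈ Finset.Icc 1 κ, residueAt κ q l * f l < 0 := by
  have hrange : ∀ (n : ℕ) (g : ℕ → ℝ),
      ∑ l ∈ Finset.Icc 1 n, g l = ∑ i ∈ Finset.range n, g (i + 1) := fun n g => by
    rw [Finset.range_eq_Ico, Finset.sum_Ico_add' g 0 n 1]
    rfl
  have hparts := Finset.sum_range_by_parts (fun i => f (i + 1)) (fun i => residueAt κ q (i + 1)) κ
  simp only [← hrange, smul_eq_mul] at hparts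
  rw [← residueSum, residueSum_self hκ hq, mul_zero, zero_sub] at hparts
  have hcomm : ∑ l ∈ Finset.Icc 1 κ, residueAt κ q l * f l
      = ∑ i ∈ Finset.range κ, f (i + 1) * residueAt κ q (i + 1) := by
    rw [hrange]
    exact Finset.sum_congr rfl fun i _ => mul_comm _ _
  rw [hcomm, hparts, neg_lt_zero]
  refine Finset.sum_pos (fun i hi => ?_) (by simp; omega)
  rw [Finset.mem_range] at hi
  have hpos := mul_pos (hf (i + 1) (by omega) (by omega))
    (residueSum_pos hq (m := i + 1) (by omega) (by omega))
  rwa [mul_mul_mul_comm, ← mul_pow, neg_one_mul, neg_neg, one_pow, one_mul] at hpos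

theorem degree_nodal_sub_X_pow_lt {R : Type*} [CommRing R] [Nontrivial R] {ι : Type*}
    (s : Finset ι) (v : ι → R) :
    (Lagrange.nodal s v - X ^ s.card).degree < (s.card : WithBot ℕ) := by
  have hdeg := degree_sub_lt_left (p := Lagrange.nodal s v) (q := X ^ s.card)
    (by rw [Lagrange.degree_nodal, degree_X_pow]) Lagrange.nodal_ne_zero
    (by rw [Lagrange.nodal_monic.leadingCoeff, (monic_X_pow _).leadingCoeff])
  rwa [Lagrange.degree_nodal] at hdeg

theorem polyQ_eq_neg_nodal {a : ℕ → ℝ} (hq : HasOrderedSimpleRoots κ (polyQ κ a) q) :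
    polyQ κ a = -Lagrange.nodal (Finset.Icc 1 κ) q := by
  have hcard : (Finset.Icc 1 κ).card = κ := by simp
  have hlow : (∑ α ∈ Finset.range κ, C (a α) * X ^ α).degree < (κ : WithBot ℕ) := by
    refine (degree_sum_le _ _).trans_lt
      ((Finset.sup_lt_iff (WithBot.bot_lt_coe κ)).2 fun α hα => ?_)
    exact (degree_C_mul_X_pow_le _ _).trans_lt (WithBot.coe_lt_coe.2 (Finset.mem_range.1 hα))
  have hinj : Set.InjOn q (Finset.Icc 1 κ : Finset ℕ) := by simpa using hq.anti.injOn
  refine eq_of_degree_sub_lt_of_eval_index_eq _ hinj ?_ fun i hi => ?_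
  · have hnodal := degree_nodal_sub_X_pow_lt (Finset.Icc 1 κ) q
    rw [hcard] at hnodal ⊢
    have hsplit : polyQ κ a - -Lagrange.nodal (Finset.Icc 1 κ) q
        = ∑ α ∈ Finset.range κ, C (a α) * X ^ α
          + (Lagrange.nodal (Finset.Icc 1 κ) q - X ^ κ) := by
      rw [polyQ]; ring
    rw [hsplit]
    exact (degree_add_le _ _).trans_lt (max_lt hlow hnodal)
  · rw [hq.root i (by simpa using hi), eval_neg, Lagrange.eval_nodal_at_node hi, neg_zero]

theorem one_div_derivative_polyQ {a : ℕ → ℝ}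
    (hq : HasOrderedSimpleRoots κ (polyQ κ a) q) {l : ℕ} (hl : l ∈ Finset.Icc 1 κ) :
    1 / (polyQ κ a).derivative.eval (q l) = residueAt κ q l := by
  rw [polyQ_eq_neg_nodal hq, residueAt, Lagrange.nodalWeight_eq_eval_derivative_nodal hl,
    derivative_neg, eval_neg, one_div, inv_neg]

theorem sum_one_div_derivative_polyQ {a : ℕ → ℝ}
    (hq : HasOrderedSimpleRoots κ (polyQ κ a) q) {m : ℕ} (hm : m ≤ κ) :
    ∑ l ∈ Finset.Icc 1 m, 1 / (polyQ κ a).derivative.eval (q l) = residueSum κ q m :=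
  Finset.sum_congr rfl fun _ hl =>
    one_div_derivative_polyQ hq (Finset.Icc_subset_Icc_right hm hl)

end Residues

/-! ### The logarithm with its branch cut pointing downwards -/

/-- The branch of `x ↦ log (x - t)` that is real for `x > t` and has its cut on the ray
`t - i [0, ∞)`, outside of the upper half plane. -/
def logSub (t : ℝ) (x : ℂ) : ℂ :=
  Complex.log (-Complex.I * (x - t)) + Complex.I * (Real.pi / 2 : ℝ)

section LogSub

variable {t : ℝ} {x : ℂ}

theorem neg_I_mul_mem_slitPlane (h : 0 < x.im ∨ x.re ≠ t) :
    -Complex.I * (x - t) ∈ Complex.slitPlane := by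
  rw [Complex.mem_slitPlane_iff]
  refine h.imp (fun him => ?_) fun hre => ?_
  · simpa using him
  · simpa [sub_eq_zero, eq_comm] using hre

theorem sub_ofReal_ne_zero (h : 0 < x.im ∨ x.re ≠ t) : x - t ≠ 0 := by
  intro h0
  have := Complex.slitPlane_ne_zero (neg_I_mul_mem_slitPlane h)
  simp [h0] at this

theorem hasDerivAt_logSub (h : 0 < x.im ∨ x.re ≠ t) :
    HasDerivAt (logSub t) (1 / (x - t)) x := by
  have hrot : HasDerivAt (fun x : ℂ => -Complex.I * (x - t)) (-Complex.I) x := by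
    simpa using ((hasDerivAt_id x).sub_const (t : ℂ)).const_mul (-Complex.I)
  have hclog := (hrot.clog (neg_I_mul_mem_slitPlane h)).add_const (Complex.I * (Real.pi / 2 : ℝ))
  refine hclog.congr_deriv ?_
  have := sub_ofReal_ne_zero h
  field_simp

theorem hasDerivAt_logSub_param (h : 0 < x.im ∨ x.re ≠ t) :
    HasDerivAt (fun t : ℝ => logSub t x) (-1 / (x - t)) t := by
  have hrot : HasDerivAt (fun t : ℝ => -Complex.I * (x - t)) (Complex.I) t := by
    simpa using ((Complex.ofRealCLM.hasDerivAt (x := t)).const_sub x).const_mul (-Complex.I)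
  have hclog := (hrot.clog_real (neg_I_mul_mem_slitPlane h)).add_const
    (Complex.I * (Real.pi / 2 : ℝ))
  refine hclog.congr_deriv ?_
  have := sub_ofReal_ne_zero h
  field_simp

theorem exp_logSub (h : x - t ≠ 0) : Complex.exp (logSub t x) = x - t := by
  have e : Complex.I * (Real.pi / 2 : ℝ) = Real.pi / 2 * Complex.I := by push_cast; ring
  rw [logSub, Complex.exp_add, Complex.exp_log (by simpa using h), e,
    Complex.exp_pi_div_two_mul_I]
  linear_combination (-(x - t)) * Complex.I_mul_I

theorem logSub_re (t : ℝ) (x : ℂ) : (logSub t x).re = Real.log ‖x - t‖ := by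
  simp [logSub, Complex.log_re]

theorem logSub_im (t : ℝ) (x : ℂ) :
    (logSub t x).im = Complex.arg (-Complex.I * (x - t)) + Real.pi / 2 := by
  rw [logSub, Complex.add_im, Complex.log_im, Complex.I_mul_im, Complex.ofReal_re]

theorem logSub_im_of_lt (h0 : x.im = 0) (h : t < x.re) : (logSub t x).im = 0 := by
  have e : -Complex.I * (x - t) = ((x.re - t : ℝ) : ℂ) * (-Complex.I) := by
    apply Complex.ext <;> simp [h0]
  rw [logSub_im, e, Complex.arg_real_mul _ (sub_pos.2 h), Complex.arg_neg_I, neg_add_cancel]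

theorem logSub_im_of_gt (h0 : x.im = 0) (h : x.re < t) : (logSub t x).im = Real.pi := by
  have e : -Complex.I * (x - t) = ((t - x.re : ℝ) : ℂ) * Complex.I := by
    apply Complex.ext <;> simp [h0]
  rw [logSub_im, e, Complex.arg_real_mul _ (sub_pos.2 h), Complex.arg_I, add_halves]

theorem logSub_im_eq_arctan (h : 0 < x.im) :
    (logSub t x).im = Real.pi / 2 - Real.arctan ((x.re - t) / x.im) := by
  have hre : (-Complex.I * (x - t)).re = x.im := by simp
  have him : (-Complex.I * (x - t)).im = -(x.re - t) := by simp
  have harg := abs_lt.1 (Complex.abs_arg_lt_pi_div_two_iff.2 (Or.inl (hre.symm ▸ h)))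
  rw [logSub_im, ← Real.arctan_tan harg.1 harg.2, Complex.tan_arg, hre, him, neg_div,
    Real.arctan_neg]
  ring

theorem logSub_im_pos (h : 0 < x.im) : 0 < (logSub t x).im := by
  rw [logSub_im_eq_arctan h]
  linarith [Real.arctan_lt_pi_div_two ((x.re - t) / x.im)]

theorem logSub_im_lt_pi (h : 0 < x.im) : (logSub t x).im < Real.pi := by
  rw [logSub_im_eq_arctan h]
  linarith [Real.neg_pi_div_two_lt_arctan ((x.re - t) / x.im)]

end LogSub

/-! ### The potential of the flow -/

theorem exists_derivative_eq {K : Type*} [Field K] [CharZero K] {p : K[X]} {n : ℕ}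
    (hp : p.degree < (n : WithBot ℕ)) :
    ∃ P : K[X], derivative P = p ∧ P.degree < ((n + 1 : ℕ) : WithBot ℕ) := by
  refine ⟨∑ i ∈ p.support, C (p.coeff i / (i + 1)) * X ^ (i + 1), ?_, ?_⟩
  · conv_rhs => rw [as_sum_support_C_mul_X_pow p]
    rw [derivative_sum]
    refine Finset.sum_congr rfl fun i _ => ?_
    have hi : (i : K) + 1 ≠ 0 := by exact_mod_cast i.succ_ne_zero
    rw [derivative_C_mul_X_pow, Nat.add_sub_cancel, Nat.cast_succ, div_mul_cancel₀ _ hi]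
  · refine (degree_sum_le _ _).trans_lt
      ((Finset.sup_lt_iff (WithBot.bot_lt_coe _)).2 fun i hi => ?_)
    have hin : i < n := WithBot.coe_lt_coe.1 ((le_degree_of_mem_supp i hi).trans_lt hp)
    exact (degree_C_mul_X_pow_le _ _).trans_lt (WithBot.coe_lt_coe.2 (Nat.succ_lt_succ hin))

theorem hasDerivAt_im {f : ℝ → ℂ} {f' : ℂ} {t : ℝ} (hf : HasDerivAt f f' t) :
    HasDerivAt (fun t => (f t).im) f'.im t :=
  Complex.imCLM.hasFDerivAt.comp_hasDerivAt t hf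

/-- The polynomial `Q = -∏ (x - q l)` as a function on `ℂ`, in terms of its roots. -/
def rootProd (κ : ℕ) (q : ℕ → ℝ) (x : ℂ) : ℂ := -∏ l ∈ Finset.Icc 1 κ, (x - q l)

/-- The primitive `F` of `1 / Q` obtained from its partial fraction decomposition. -/
def potential (κ : ℕ) (q : ℕ → ℝ) (x : ℂ) : ℂ :=
  ∑ l ∈ Finset.Icc 1 κ, (residueAt κ q l : ℂ) * logSub (q l) x

/-- The points where every `logSub (q l)` is holomorphic, in as far as they belong to the closed
upper half plane. -/
def OffCuts (κ : ℕ) (q : ℕ → ℝ) (x : ℂ) : Prop :=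
  ∀ l ∈ Finset.Icc 1 κ, 0 < x.im ∨ x.re ≠ q l

/-- The real number `t` lies between the `m`-th and the `(m + 1)`-st root, counted from the
right. The unbounded intervals are included as `m = 0` and `m = κ`. -/
def InCell (κ : ℕ) (q : ℕ → ℝ) (m : ℕ) (t : ℝ) : Prop :=
  ∀ l ∈ Finset.Icc 1 κ, (l ≤ m → t < q l) ∧ (m < l → q l < t)

section Cells

variable {κ : ℕ} {q : ℕ → ℝ} {m : ℕ} {t : ℝ}

theorem inCell_of_mem_Ioo (hq : StrictAntiOn q (Set.Icc 1 κ)) (hlo : 1 ≤ m) (hhi : m < κ)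
    (ht : t ∈ Set.Ioo (q (m + 1)) (q m)) : InCell κ q m t := by
  intro l hl
  rw [Finset.mem_Icc] at hl
  refine ⟨fun h => ht.2.trans_le ?_, fun h => lt_of_le_of_lt ?_ ht.1⟩
  · exact hq.antitoneOn hl ⟨hlo, hhi.le⟩ h
  · exact hq.antitoneOn ⟨by omega, hhi⟩ hl h

theorem InCell.ne (h : InCell κ q m t) {l : ℕ} (hl : l ∈ Finset.Icc 1 κ) : t ≠ q l := by
  rcases le_or_gt l m with h' | h'
  · exact ((h l hl).1 h').ne
  · exact ((h l hl).2 h').ne'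

theorem InCell.prod_sub_pos (h : InCell κ q m t) {a b : ℕ} (ha : 1 ≤ a) (hb : b ≤ κ)
    (hmb : m ≤ b) : 0 < (-1) ^ (m + 1 - a) * ∏ l ∈ Finset.Icc a b, (t - q l) := by
  have hmem : ∀ l ∈ Finset.Icc a b, l ∈ Finset.Icc 1 κ := fun l hl =>
    Finset.Icc_subset_Icc ha hb hl
  have hneg : (Finset.Icc a b).filter (fun l => t - q l < 0) = Finset.Icc a m := by
    ext l
    rw [Finset.mem_filter, sub_neg]
    constructor
    · rintro ⟨hl, hlt⟩
      exact Finset.mem_Icc.2 ⟨(Finset.mem_Icc.1 hl).1,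
        not_lt.1 fun hml => hlt.not_gt ((h l (hmem l hl)).2 hml)⟩
    · intro hl
      have hl' := Finset.Icc_subset_Icc_right hmb hl
      exact ⟨hl', (h l (hmem l hl')).1 (Finset.mem_Icc.1 hl).2⟩
  rw [← Nat.card_Icc, ← hneg]
  exact neg_one_pow_card_mul_prod_pos fun l hl => sub_ne_zero.2 (h.ne (hmem l hl))

end Cells

section Potential

variable {κ : ℕ} {q : ℕ → ℝ} {x : ℂ}

theorem rootProd_ne_zero_iff : rootProd κ q x ≠ 0 ↔ ∀ l ∈ Finset.Icc 1 κ, x - q l ≠ 0 := by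
  rw [rootProd, neg_ne_zero, Finset.prod_ne_zero_iff]

theorem differentiable_rootProd : Differentiable ℂ (rootProd κ q) := by
  unfold rootProd
  fun_prop

theorem rootProd_ofReal (t : ℝ) :
    rootProd κ q t = ((-∏ l ∈ Finset.Icc 1 κ, (t - q l) : ℝ) : ℂ) := by
  simp [rootProd]

theorem rootProd_eq_mul (hκ : 2 ≤ κ) (x : ℂ) :
    rootProd κ q x = -((x - q 1) * (x - q κ) *
      (Lagrange.nodal (Finset.Icc 2 (κ - 1)) (fun l => (q l : ℂ))).eval x) := by
  have e : Finset.Icc 1 κ = insert 1 (insert κ (Finset.Icc 2 (κ - 1))) := by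
    ext l; simp only [Finset.mem_insert, Finset.mem_Icc]; omega
  rw [rootProd, Lagrange.eval_nodal, e, Finset.prod_insert (by simp; omega),
    Finset.prod_insert (by simp; omega)]
  ring

theorem OffCuts.sub_ne_zero (h : OffCuts κ q x) {l : ℕ} (hl : l ∈ Finset.Icc 1 κ) :
    x - q l ≠ 0 := sub_ofReal_ne_zero (h l hl)

theorem OffCuts.rootProd_ne_zero (h : OffCuts κ q x) : rootProd κ q x ≠ 0 :=
  rootProd_ne_zero_iff.2 fun _ hl => h.sub_ne_zero hl

theorem sum_residueAt_div (hκ : 1 ≤ κ) (hq : StrictAntiOn q (Set.Icc 1 κ))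
    (hx : ∀ l ∈ Finset.Icc 1 κ, x - q l ≠ 0) :
    ∑ l ∈ Finset.Icc 1 κ, (residueAt κ q l : ℂ) * (1 / (x - q l)) = 1 / rootProd κ q x := by
  have hone := congrArg (eval x)
    (Lagrange.interpolate_one (injOn_ofReal_comp hq) ⟨1, by simpa using hκ⟩)
  rw [Lagrange.eval_interpolate_not_at_node _ (fun l hl => sub_ne_zero.1 (hx l hl)),
    Lagrange.eval_nodal, eval_one] at hone
  have hterm : ∀ l ∈ Finset.Icc 1 κ, (residueAt κ q l : ℂ) * (1 / (x - q l))
      = -(Lagrange.nodalWeight (Finset.Icc 1 κ) (fun l => (q l : ℂ)) l * (x - q l)⁻¹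
        * (1 : ℕ → ℂ) l) := fun l _ => by
    rw [ofReal_residueAt, Pi.one_apply]
    ring
  rw [eq_div_iff (rootProd_ne_zero_iff.2 hx), Finset.sum_congr rfl hterm, Finset.sum_neg_distrib,
    rootProd, neg_mul_neg, mul_comm, hone]

theorem hasDerivAt_potential (hκ : 1 ≤ κ) (hq : StrictAntiOn q (Set.Icc 1 κ))
    (h : OffCuts κ q x) : HasDerivAt (potential κ q) (1 / rootProd κ q x) x := by
  rw [← sum_residueAt_div hκ hq fun l hl => h.sub_ne_zero hl]
  exact HasDerivAt.fun_sum fun l hl => (hasDerivAt_logSub (h l hl)).const_mul _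

theorem potential_re (x : ℂ) : (potential κ q x).re
    = ∑ l ∈ Finset.Icc 1 κ, residueAt κ q l * Real.log ‖x - q l‖ := by
  rw [potential, Complex.re_sum]
  exact Finset.sum_congr rfl fun l _ => by rw [Complex.re_ofReal_mul, logSub_re]

theorem sum_logSub_im_of_inCell {m : ℕ} (c : ℕ → ℝ) (h0 : x.im = 0) (h : InCell κ q m x.re)
    (hm : m ≤ κ) : ∑ l ∈ Finset.Icc 1 κ, c l * (logSub (q l) x).im
      = Real.pi * ∑ l ∈ Finset.Icc 1 m, c l := by
  have hsub : Finset.Icc 1 m ⊆ Finset.Icc 1 κ := Finset.Icc_subset_Icc_right hm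
  rw [← Finset.sum_subset hsub fun l hl hlm => ?_, Finset.mul_sum]
  · refine Finset.sum_congr rfl fun l hl => ?_
    rw [logSub_im_of_gt h0 ((h l (hsub hl)).1 (Finset.mem_Icc.1 hl).2), mul_comm]
  · have hml : m < l := by
      simp only [Finset.mem_Icc] at hl hlm
      omega
    rw [logSub_im_of_lt h0 ((h l hl).2 hml), mul_zero]

theorem potential_im_of_inCell {m : ℕ} (h0 : x.im = 0) (h : InCell κ q m x.re) (hm : m ≤ κ) :
    (potential κ q x).im = Real.pi * residueSum κ q m := by
  rw [residueSum, ← sum_logSub_im_of_inCell _ h0 h hm, potential, Complex.im_sum]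
  exact Finset.sum_congr rfl fun l _ => by rw [Complex.im_ofReal_mul]

end Potential

/-! ### The potential is starlike -/

section Starlike

variable {κ : ℕ} {q : ℕ → ℝ} {x : ℂ}

theorem im_mul_div_pos {a b t : ℝ} (h : 0 < x.im) (hb : b ≤ t) (ha : t ≤ a) :
    0 < ((x - a) * (x - b) / (x - t)).im := by
  have hne : x - t ≠ 0 := sub_ofReal_ne_zero (Or.inl h)
  have hsplit : (x - a) * (x - b) / (x - t)
      = x + ((t - a - b : ℝ) : ℂ) + (((t - a) * (t - b) : ℝ) : ℂ) * (x - t)⁻¹ := by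
    field_simp; push_cast; ring
  rw [hsplit, Complex.add_im, Complex.add_im, Complex.ofReal_im, Complex.im_ofReal_mul,
    Complex.inv_im, Complex.sub_im, Complex.ofReal_im, sub_zero, add_zero]
  have hcoeff : (t - a) * (t - b) ≤ 0 :=
    mul_nonpos_of_nonpos_of_nonneg (sub_nonpos.2 ha) (sub_nonneg.2 hb)
  have hinv : -x.im / Complex.normSq (x - t) ≤ 0 :=
    div_nonpos_of_nonpos_of_nonneg (neg_nonpos.2 h.le) (Complex.normSq_nonneg _)
  linarith [mul_nonneg_of_nonpos_of_nonpos hcoeff hinv]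

-- Subtracting the polynomial `H` makes the derivative in `t` change sign only at the inner roots.
theorem exists_hasDerivAt_im_rootProd_mul_logSub_sub (hκ : 2 ≤ κ) (q : ℕ → ℝ) (h : 0 < x.im) :
    ∃ H : ℂ[X], H.degree < ((κ - 1 : ℕ) : WithBot ℕ) ∧ ∀ t : ℝ,
      HasDerivAt (fun t : ℝ => (rootProd κ q x * logSub t x - H.eval (t : ℂ)).im)
        ((∏ l ∈ Finset.Icc 2 (κ - 1), (t - q l)) * ((x - q 1) * (x - q κ) / (x - t)).im) t := by
  set p : ℂ[X] := Lagrange.nodal (Finset.Icc 2 (κ - 1)) fun l => (q l : ℂ) with hp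
  set A : ℂ := (x - q 1) * (x - q κ) with hA
  have hpdeg : p.degree = ((κ - 2 : ℕ) : WithBot ℕ) := by
    rw [hp, Lagrange.degree_nodal, Nat.card_Icc]
    congr 1
  have hquot : (A • (p /ₘ (X - C x))).degree < ((κ - 2 : ℕ) : WithBot ℕ) := by
    refine (degree_smul_le _ _).trans_lt (hpdeg ▸ ?_)
    exact degree_divByMonic_lt _ _ Lagrange.nodal_ne_zero (by rw [degree_X_sub_C]; exact one_pos)
  obtain ⟨H, hH, hHdeg⟩ := exists_derivative_eq hquot
  refine ⟨H, by rwa [show κ - 2 + 1 = κ - 1 by omega] at hHdeg, fun t => ?_⟩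
  have hne : x - t ≠ 0 := sub_ofReal_ne_zero (Or.inl h)
  have hdiv : (t - x) * (p /ₘ (X - C x)).eval (t : ℂ) = p.eval (t : ℂ) - p.eval x := by
    simpa using congrArg (eval (t : ℂ)) (X_sub_C_mul_divByMonic_eq_sub_modByMonic p x)
  have hpt : p.eval (t : ℂ) = ((∏ l ∈ Finset.Icc 2 (κ - 1), (t - q l) : ℝ) : ℂ) := by
    rw [hp, Lagrange.eval_nodal]
    push_cast
    rfl
  refine (hasDerivAt_im (((hasDerivAt_logSub_param (Or.inl h)).const_mul (rootProd κ q x)).sub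
    (H.hasDerivAt (t : ℂ)).comp_ofReal)).congr_deriv ?_
  rw [← Complex.im_ofReal_mul, ← hpt, rootProd_eq_mul hκ, ← hp, ← hA, hH, eval_smul, smul_eq_mul]
  congr 1
  field_simp
  linear_combination A * hdiv

theorem im_rootProd_mul_potential_neg (hκ : 2 ≤ κ) (hq : StrictAntiOn q (Set.Icc 1 κ))
    (h : 0 < x.im) : (rootProd κ q x * potential κ q x).im < 0 := by
  obtain ⟨H, hHdeg, hderiv⟩ := exists_hasDerivAt_im_rootProd_mul_logSub_sub hκ q h
  set g : ℝ → ℝ := fun t => (rootProd κ q x * logSub t x - H.eval (t : ℂ)).im with hg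
  have hsum : (rootProd κ q x * potential κ q x).im
      = ∑ l ∈ Finset.Icc 1 κ, residueAt κ q l * g (q l) := by
    have hH := sum_residueAt_mul_eval hq (hHdeg.trans_le (by exact_mod_cast κ.sub_le 1))
    rw [coeff_eq_zero_of_degree_lt hHdeg, neg_zero] at hH
    simp_rw [hg, ← Complex.im_ofReal_mul, ← Complex.im_sum, mul_sub, Finset.sum_sub_distrib]
    rw [hH, sub_zero, potential, Finset.mul_sum]
    simp_rw [mul_left_comm]
  rw [hsum]
  refine sum_residueAt_mul_neg hκ hq fun m hlo hhi => ?_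
  have hlt : q (m + 1) < q m := hq ⟨hlo, hhi.le⟩ ⟨by omega, hhi⟩ (by omega)
  have hmono : StrictMonoOn (fun t => (-1) ^ (m + 1) * g t) (Set.Icc (q (m + 1)) (q m)) := by
    refine strictMonoOn_of_deriv_pos (convex_Icc _ _)
      (fun t _ => ((hderiv t).const_mul _).continuousAt.continuousWithinAt) fun t ht => ?_
    rw [interior_Icc] at ht
    have hcell := inCell_of_mem_Ioo hq hlo hhi ht
    have hinner := hcell.prod_sub_pos (a := 2) (b := κ - 1) (by omega) (by omega) (by omega)
    have hsign : (-1 : ℝ) ^ (m + 1) = (-1) ^ (m + 1 - 2) := by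
      rw [← Nat.sub_add_cancel (show 2 ≤ m + 1 by omega), pow_add, neg_one_sq, mul_one,
        Nat.add_sub_cancel]
    rw [((hderiv t).const_mul _).deriv, ← mul_assoc, hsign]
    refine mul_pos hinner (im_mul_div_pos h ?_ ?_)
    · exact ((hcell κ (by simp; omega)).2 hhi).le
    · exact ((hcell 1 (by simp; omega)).1 hlo).le
  have hend := hmono (Set.left_mem_Icc.2 hlt.le) (Set.right_mem_Icc.2 hlt.le) hlt
  simp only [pow_succ] at hend
  linear_combination hend

/-- The open upper half plane together with the bounded intervals between the roots. -/
def Regular (κ : ℕ) (q : ℕ → ℝ) (x : ℂ) : Prop :=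
  0 < x.im ∨ (x.im = 0 ∧ ∃ m, 1 ≤ m ∧ m < κ ∧ InCell κ q m x.re)

theorem Regular.im_nonneg (h : Regular κ q x) : 0 ≤ x.im :=
  h.elim le_of_lt fun h => h.1.ge

theorem Regular.offCuts (h : Regular κ q x) : OffCuts κ q x := by
  intro l hl
  rcases h with h | ⟨-, m, -, -, h⟩
  · exact Or.inl h
  · exact Or.inr (h.ne hl)

theorem Regular.im_neg (hκ : 2 ≤ κ) (hq : StrictAntiOn q (Set.Icc 1 κ)) (h : Regular κ q x) :
    (rootProd κ q x * potential κ q x).im < 0 := by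
  rcases h with h | ⟨h0, m, hlo, hhi, h⟩
  · exact im_rootProd_mul_potential_neg hκ hq h
  · have hreal : rootProd κ q x = ((-∏ l ∈ Finset.Icc 1 κ, (x.re - q l) : ℝ) : ℂ) := by
      rw [← rootProd_ofReal, Complex.ext (Complex.ofReal_re x.re) (h0 ▸ Complex.ofReal_im x.re)]
    have hprod := h.prod_sub_pos le_rfl le_rfl hhi.le
    rw [Nat.add_sub_cancel] at hprod
    have hpos := mul_pos (mul_pos hprod (residueSum_pos hq hlo hhi)) Real.pi_pos
    rw [mul_mul_mul_comm, ← mul_pow, neg_one_mul, neg_neg, one_pow, one_mul] at hpos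
    rw [hreal, Complex.im_ofReal_mul, potential_im_of_inCell h0 h hhi.le]
    linear_combination hpos

theorem Regular.mul_ne_zero (hκ : 2 ≤ κ) (hq : StrictAntiOn q (Set.Icc 1 κ))
    (h : Regular κ q x) : rootProd κ q x * potential κ q x ≠ 0 := fun h0 => by
  have := h.im_neg hκ hq
  simp [h0] at this

end Starlike

/-! ### The logarithm of the potential -/

section NoshiroWarschawski

theorem im_div_sub_pos_of_segment {f f' : ℂ → ℂ} {x y : ℂ} (hxy : x ≠ y)
    (hf : ∀ z ∈ segment ℝ x y, HasDerivAt f (f' z) z)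
    (hf' : ∀ z ∈ segment ℝ x y, 0 < (f' z).im) : 0 < ((f y - f x) / (y - x)).im := by
  have hne : y - x ≠ 0 := sub_ne_zero.2 hxy.symm
  have hseg : ∀ t ∈ Set.Icc (0 : ℝ) 1, x + t * (y - x) ∈ segment ℝ x y := fun t ht => by
    rw [segment_eq_image']
    exact ⟨t, ht, by simp⟩
  have hderiv : ∀ t ∈ Set.Icc (0 : ℝ) 1,
      HasDerivAt (fun t : ℝ => (f (x + t * (y - x)) / (y - x)).im)
        (f' (x + t * (y - x))).im t := by
    intro t ht
    have hline : HasDerivAt (fun t : ℂ => x + t * (y - x)) (y - x) (t : ℂ) := by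
      simpa using ((hasDerivAt_id (t : ℂ)).mul_const (y - x)).const_add x
    refine (hasDerivAt_im (((hf _ (hseg t ht)).comp (t : ℂ) hline).div_const
      (y - x)).comp_ofReal).congr_deriv ?_
    rw [mul_div_cancel_right₀ _ hne]
  have hmono : StrictMonoOn (fun t : ℝ => (f (x + t * (y - x)) / (y - x)).im) (Set.Icc 0 1) := by
    refine strictMonoOn_of_deriv_pos (convex_Icc _ _)
      (fun t ht => (hderiv t ht).continuousAt.continuousWithinAt) fun t ht => ?_
    have ht' := interior_subset ht
    rw [(hderiv t ht').deriv]
    exact hf' _ (hseg t ht')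
  have hlt := hmono (Set.left_mem_Icc.2 zero_le_one) (Set.right_mem_Icc.2 zero_le_one) zero_lt_one
  rw [sub_div, Complex.sub_im, sub_pos]
  simpa using hlt

end NoshiroWarschawski

/-- A logarithm of the potential, holomorphic on the regular points. The correction terms undo the
factor `Q` in the argument of the principal logarithm, which the inequality `Im (Q F) < 0` keeps
away from the cut. -/
def logPotential (κ : ℕ) (q : ℕ → ℝ) (x : ℂ) : ℂ :=
  Complex.log (rootProd κ q x * potential κ q x) + Real.pi * Complex.I
    - ∑ l ∈ Finset.Icc 1 κ, logSub (q l) x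

section LogPotential

variable {κ : ℕ} {q : ℕ → ℝ} {x : ℂ}

theorem exp_logPotential (h : rootProd κ q x * potential κ q x ≠ 0) :
    Complex.exp (logPotential κ q x) = potential κ q x := by
  have hne := rootProd_ne_zero_iff.1 (left_ne_zero_of_mul h)
  have hprod : ∏ l ∈ Finset.Icc 1 κ, (x - q l) ≠ 0 := Finset.prod_ne_zero_iff.2 hne
  rw [logPotential, Complex.exp_sub, Complex.exp_add, Complex.exp_log h, Complex.exp_pi_mul_I,
    Complex.exp_sum, Finset.prod_congr rfl fun l hl => exp_logSub (hne l hl), rootProd]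
  field_simp

theorem Regular.exp_logPotential (hκ : 2 ≤ κ) (hq : StrictAntiOn q (Set.Icc 1 κ))
    (h : Regular κ q x) : Complex.exp (logPotential κ q x) = potential κ q x :=
  _root_.exp_logPotential (h.mul_ne_zero hκ hq)

theorem Regular.hasDerivAt_logPotential (hκ : 2 ≤ κ) (hq : StrictAntiOn q (Set.Icc 1 κ))
    (h : Regular κ q x) :
    HasDerivAt (logPotential κ q) (1 / (rootProd κ q x * potential κ q x)) x := by
  have hne := h.mul_ne_zero hκ hq
  have hF := hasDerivAt_potential (one_le_two.trans hκ) hq h.offCuts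
  have hQF : DifferentiableAt ℂ (fun x => rootProd κ q x * potential κ q x) x :=
    (differentiable_rootProd x).mul hF.differentiableAt
  have hdiff : DifferentiableAt ℂ (logPotential κ q) x := by
    refine ((hQF.clog (Complex.mem_slitPlane_iff.2 (Or.inr (h.im_neg hκ hq).ne))).add_const
      _).sub ?_
    exact DifferentiableAt.fun_sum fun l hl =>
      (hasDerivAt_logSub (h.offCuts l hl)).differentiableAt
  have hexp : ∀ᶠ y in 𝓝 x, Complex.exp (logPotential κ q y) = potential κ q y :=
    (hQF.continuousAt.eventually_ne hne).mono fun y hy => _root_.exp_logPotential hy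
  have hchain := hdiff.hasDerivAt.cexp.unique (hF.congr_of_eventuallyEq hexp)
  rw [h.exp_logPotential hκ hq] at hchain
  refine hdiff.hasDerivAt.congr_deriv ?_
  rw [eq_div_iff hne, mul_comm (rootProd κ q x), ← mul_assoc, mul_comm _ (potential κ q x), hchain,
    one_div_mul_cancel (left_ne_zero_of_mul hne)]

theorem Regular.im_deriv_pos (hκ : 2 ≤ κ) (hq : StrictAntiOn q (Set.Icc 1 κ))
    (h : Regular κ q x) : 0 < (1 / (rootProd κ q x * potential κ q x)).im := by
  rw [one_div, Complex.inv_im]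
  exact div_pos (neg_pos.2 (h.im_neg hκ hq)) (Complex.normSq_pos.2 (h.mul_ne_zero hκ hq))

theorem logPotential_im (x : ℂ) : (logPotential κ q x).im
    = Complex.arg (rootProd κ q x * potential κ q x) + Real.pi
      - ∑ l ∈ Finset.Icc 1 κ, (logSub (q l) x).im := by
  rw [logPotential, Complex.sub_im, Complex.add_im, Complex.log_im, Complex.im_sum,
    Complex.im_ofReal_mul, Complex.I_im, mul_one]

theorem im_logPotential_sub_div_pos (hκ : 2 ≤ κ) (hq : StrictAntiOn q (Set.Icc 1 κ)) {y : ℂ}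
    (hxy : x ≠ y) (h : ∀ z ∈ segment ℝ x y, Regular κ q z) :
    0 < ((logPotential κ q y - logPotential κ q x) / (y - x)).im :=
  im_div_sub_pos_of_segment hxy (fun z hz => (h z hz).hasDerivAt_logPotential hκ hq)
    fun z hz => (h z hz).im_deriv_pos hκ hq

end LogPotential

/-! ### Level curves -/

/-- The argument of the potential along the `j`-th separatrix. -/
def levelArg (j : ℕ) : ℝ := -((j : ℝ) - 1 / 2) * Real.pi

theorem levelArg_neg {j : ℕ} (hj : 1 ≤ j) : levelArg j < 0 := by
  have hj' : (1 : ℝ) ≤ j := by exact_mod_cast hj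
  exact mul_neg_of_neg_of_pos (by linarith) Real.pi_pos

theorem pi_sub_mul_pi_lt_levelArg {j κ : ℕ} (hj : j < κ) :
    Real.pi - κ * Real.pi < levelArg j := by
  have hj' : (j : ℝ) + 1 ≤ κ := by exact_mod_cast hj
  rw [levelArg]
  nlinarith [Real.pi_pos]

theorem exp_levelArg_mul_I (j : ℕ) :
    Complex.exp (levelArg j * Complex.I) = Complex.I * (-1) ^ j := by
  have hsplit : (levelArg j * Complex.I : ℂ)
      = Real.pi / 2 * Complex.I - j * (Real.pi * Complex.I) := by
    rw [levelArg]; push_cast; ring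
  rw [hsplit, Complex.exp_sub, Complex.exp_pi_div_two_mul_I, Complex.exp_nat_mul,
    Complex.exp_pi_mul_I, div_eq_mul_inv, ← inv_pow, inv_neg, inv_one]

theorem continuous_complex_mk : Continuous fun p : ℝ × ℝ => (⟨p.1, p.2⟩ : ℂ) :=
  Complex.equivRealProdCLM.symm.continuous

theorem continuousWithinAt_of_level {Φ : ℝ → ℝ → ℝ} {w : ℝ → ℝ} {s : Set ℝ} {y₀ c : ℝ}
    (hw : ∀ y ∈ s, Φ (w y) y = c)
    (hmono : ∀ᶠ y in 𝓝[s] y₀, y ≠ y₀ → StrictMono fun u => Φ u y)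
    (hleft : ∀ᶠ u in 𝓝[<] w y₀, Φ u y₀ < c) (hright : ∀ᶠ u in 𝓝[>] w y₀, c < Φ u y₀)
    (hcont : ∀ᶠ u in 𝓝 (w y₀), ContinuousWithinAt (Φ u) s y₀) :
    ContinuousWithinAt w s y₀ := by
  refine tendsto_order.2 ⟨fun a ha => ?_, fun a ha => ?_⟩
  · obtain ⟨u, ⟨hu, hucont⟩, hau, huw⟩ :=
      ((hleft.and (hcont.filter_mono nhdsWithin_le_nhds)).and (Ioo_mem_nhdsLT ha)).exists
    filter_upwards [hucont.eventually_lt_const hu, hmono, self_mem_nhdsWithin] with y hy hmy hys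
    rcases eq_or_ne y y₀ with rfl | hne
    · exact ha
    · rw [← hw y hys] at hy
      exact hau.trans ((hmy hne).lt_iff_lt.1 hy)
  · obtain ⟨u, ⟨hu, hucont⟩, hwu, hua⟩ :=
      ((hright.and (hcont.filter_mono nhdsWithin_le_nhds)).and (Ioo_mem_nhdsGT ha)).exists
    filter_upwards [hucont.eventually_const_lt hu, hmono, self_mem_nhdsWithin] with y hy hmy hys
    rcases eq_or_ne y y₀ with rfl | hne
    · exact ha
    · rw [← hw y hys] at hy
      exact ((hmy hne).lt_iff_lt.1 hy).trans hua

theorem tendsto_log_norm_sub (t₀ : ℝ) :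
    Tendsto (fun t : ℝ => Real.log ‖(t : ℂ) - t₀‖) (𝓝[≠] t₀) atBot := by
  have hnorm : Tendsto (fun t : ℝ => ‖t - t₀‖) (𝓝[≠] t₀) (𝓝[≠] 0) :=
    (tendsto_norm_sub_self_nhdsNE t₀).mono_right (nhdsGT_le_nhdsNE _)
  refine (Real.tendsto_log_nhdsNE_zero.comp hnorm).congr fun t => ?_
  rw [Function.comp, ← Complex.ofReal_sub, Complex.norm_real]

theorem tendsto_logSub_im_atTop {t y : ℝ} (hy : 0 < y) :
    Tendsto (fun u : ℝ => (logSub t ⟨u, y⟩).im) atTop (𝓝 0) := by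
  have hquot : Tendsto (fun u : ℝ => (u - t) / y) atTop atTop :=
    (tendsto_atTop_add_const_right _ (-t) tendsto_id).atTop_div_const hy
  have harctan := ((Real.tendsto_arctan_atTop.mono_right nhdsWithin_le_nhds).comp hquot).const_sub
    (Real.pi / 2)
  rw [sub_self] at harctan
  exact harctan.congr fun u => (logSub_im_eq_arctan (x := ⟨u, y⟩) hy).symm

theorem tendsto_logSub_im_atBot {t y : ℝ} (hy : 0 < y) :
    Tendsto (fun u : ℝ => (logSub t ⟨u, y⟩).im) atBot (𝓝 Real.pi) := by
  have hquot : Tendsto (fun u : ℝ => (u - t) / y) atBot atBot :=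
    (tendsto_atBot_add_const_right _ (-t) tendsto_id).atBot_div_const hy
  have harctan := ((Real.tendsto_arctan_atBot.mono_right nhdsWithin_le_nhds).comp hquot).const_sub
    (Real.pi / 2)
  rw [sub_neg_eq_add, add_halves] at harctan
  exact harctan.congr fun u => (logSub_im_eq_arctan (x := ⟨u, y⟩) hy).symm

section LevelCurve

variable {κ : ℕ} {q : ℕ → ℝ}

theorem tendsto_potential_re_root (hq : StrictAntiOn q (Set.Icc 1 κ)) {m : ℕ}
    (hlo : 1 ≤ m) (hhi : m ≤ κ) :
    Tendsto (fun t : ℝ => (-1) ^ m * (potential κ q t).re) (𝓝[≠] q m) atBot := by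
  have hm : m ∈ Finset.Icc 1 κ := Finset.mem_Icc.2 ⟨hlo, hhi⟩
  have hsing := (tendsto_log_norm_sub (q m)).const_mul_atBot (residueAt_pos hq hlo hhi)
  have hrest : ContinuousAt (fun t : ℝ => ∑ l ∈ (Finset.Icc 1 κ).erase m,
      (-1) ^ m * (residueAt κ q l * Real.log ‖(t : ℂ) - q l‖)) (q m) := by
    refine tendsto_finsetSum _ fun l hl => ?_
    rw [Finset.mem_erase, Finset.mem_Icc] at hl
    have hne : (q m : ℂ) - q l ≠ 0 := by
      rw [← Complex.ofReal_sub, Complex.ofReal_ne_zero, sub_ne_zero]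
      exact fun h => hl.1 (hq.injOn hl.2 ⟨hlo, hhi⟩ h.symm)
    have hnorm : ContinuousAt (fun t : ℝ => ‖(t : ℂ) - q l‖) (q m) := by fun_prop
    exact ((hnorm.log (norm_ne_zero_iff.2 hne)).const_mul _).const_mul _
  refine (hsing.atBot_add (hrest.tendsto.mono_left nhdsWithin_le_nhds)).congr fun t => ?_
  rw [potential_re, ← Finset.add_sum_erase _ _ hm, mul_add, Finset.mul_sum, mul_assoc]

theorem exists_potential_re_eq_zero (hq : StrictAntiOn q (Set.Icc 1 κ)) {j : ℕ}
    (hlo : 1 ≤ j) (hhi : j < κ) :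
    ∃ p ∈ Set.Ioo (q (j + 1)) (q j), (potential κ q p).re = 0 := by
  have hlt : q (j + 1) < q j := hq ⟨hlo, hhi.le⟩ ⟨by omega, hhi⟩ (by omega)
  have hcont : ContinuousOn (fun t : ℝ => (-1) ^ j * (potential κ q t).re)
      (Set.Ioo (q (j + 1)) (q j)) := fun t ht => by
    have hoff : OffCuts κ q t := fun l hl => Or.inr ((inCell_of_mem_Ioo hq hlo hhi ht).ne hl)
    have hF : ContinuousAt (fun t : ℝ => potential κ q t) t :=
      (hasDerivAt_potential (by omega) hq hoff).continuousAt.comp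
        Complex.continuous_ofReal.continuousAt
    exact ((Complex.continuous_re.continuousAt.comp hF).const_mul _).continuousWithinAt
  obtain ⟨t₁, hneg, ht₁⟩ := ((((tendsto_potential_re_root hq hlo hhi.le).mono_left
    (nhdsLT_le_nhdsNE _)).eventually_lt_atBot 0).and (Ioo_mem_nhdsLT hlt)).exists
  obtain ⟨t₂, hpos, ht₂⟩ := ((((tendsto_potential_re_root hq (by omega) hhi).mono_left
    (nhdsGT_le_nhdsNE _)).eventually_lt_atBot 0).and (Ioo_mem_nhdsGT hlt)).exists
  rw [pow_succ, mul_neg_one, neg_mul, neg_lt_zero] at hpos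
  obtain ⟨p, hp, hp0⟩ := isPreconnected_Ioo.intermediate_value ht₁ ht₂ hcont ⟨hneg.le, hpos.le⟩
  exact ⟨p, hp, by simpa using hp0⟩

theorem InCell.eventually {m : ℕ} {t₀ : ℝ} (h : InCell κ q m t₀) :
    ∀ᶠ t in 𝓝 t₀, InCell κ q m t :=
  (eventually_all_finset _).2 fun l hl =>
    (eventually_imp_distrib_left.2 fun hlm => eventually_lt_nhds ((h l hl).1 hlm)).and
      (eventually_imp_distrib_left.2 fun hml => eventually_gt_nhds ((h l hl).2 hml))

theorem Regular.eventually_horizontal {u y : ℝ} (h : Regular κ q ⟨u, y⟩) :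
    ∀ᶠ t in 𝓝 u, Regular κ q ⟨t, y⟩ := by
  rcases h with h | ⟨h0, m, hlo, hhi, h⟩
  · exact Eventually.of_forall fun _ => Or.inl h
  · exact h.eventually.mono fun _ ht => Or.inr ⟨h0, m, hlo, hhi, ht⟩

theorem Regular.continuousAt_logPotential_im_mk (hκ : 2 ≤ κ) (hq : StrictAntiOn q (Set.Icc 1 κ))
    {u y : ℝ} (h : Regular κ q ⟨u, y⟩) :
    ContinuousAt (fun p : ℝ × ℝ => (logPotential κ q ⟨p.1, p.2⟩).im) (u, y) :=
  Complex.continuous_im.continuousAt.comp <|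
    (h.hasDerivAt_logPotential hκ hq).continuousAt.comp (x := (u, y))
      (f := fun p : ℝ × ℝ => (⟨p.1, p.2⟩ : ℂ)) continuous_complex_mk.continuousAt

theorem logPotential_im_lt (hκ : 2 ≤ κ) (hq : StrictAntiOn q (Set.Icc 1 κ)) {u v y : ℝ}
    (huv : u < v) (h : ∀ t ∈ Set.Icc u v, Regular κ q ⟨t, y⟩) :
    (logPotential κ q ⟨u, y⟩).im < (logPotential κ q ⟨v, y⟩).im := by
  have hpos := im_logPotential_sub_div_pos hκ hq (x := ⟨u, y⟩) (y := ⟨v, y⟩)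
    (fun e => huv.ne (congrArg Complex.re e)) <| by
      rintro z ⟨a, b, ha, hb, hab, rfl⟩
      have hz : a • (⟨u, y⟩ : ℂ) + b • ⟨v, y⟩ = ⟨a • u + b • v, y⟩ := by
        apply Complex.ext
        · simp
        · simp [← add_mul, hab]
      rw [hz]
      exact h _ (convex_Icc u v ⟨le_rfl, huv.le⟩ ⟨huv.le, le_rfl⟩ ha hb hab)
  have hdiff : (⟨v, y⟩ : ℂ) - ⟨u, y⟩ = ((v - u : ℝ) : ℂ) := by apply Complex.ext <;> simp
  rw [hdiff, Complex.div_ofReal_im, div_pos_iff_of_pos_right (sub_pos.2 huv), Complex.sub_im,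
    sub_pos] at hpos
  exact hpos

theorem strictMono_logPotential_im (hκ : 2 ≤ κ) (hq : StrictAntiOn q (Set.Icc 1 κ)) {y : ℝ}
    (hy : 0 < y) : StrictMono fun u : ℝ => (logPotential κ q ⟨u, y⟩).im :=
  fun _ _ huv => logPotential_im_lt hκ hq huv fun _ _ => Or.inl hy

theorem eventually_lt_logPotential_im_atTop {y c : ℝ} (hy : 0 < y) (hc : c < 0) :
    ∀ᶠ u : ℝ in atTop, c < (logPotential κ q ⟨u, y⟩).im := by
  have hsum : Tendsto (fun u : ℝ => ∑ l ∈ Finset.Icc 1 κ, (logSub (q l) ⟨u, y⟩).im) atTop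
      (𝓝 (∑ _l ∈ Finset.Icc 1 κ, 0)) :=
    tendsto_finsetSum _ fun l _ => tendsto_logSub_im_atTop hy
  rw [Finset.sum_const_zero] at hsum
  filter_upwards [hsum.eventually_lt_const (neg_pos.2 hc)] with u hu
  rw [logPotential_im]
  linarith [Complex.neg_pi_lt_arg (rootProd κ q ⟨u, y⟩ * potential κ q ⟨u, y⟩)]

theorem eventually_logPotential_im_lt_atBot (hκ : 2 ≤ κ) (hq : StrictAntiOn q (Set.Icc 1 κ))
    {y c : ℝ} (hy : 0 < y) (hc : Real.pi - κ * Real.pi < c) :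
    ∀ᶠ u : ℝ in atBot, (logPotential κ q ⟨u, y⟩).im < c := by
  have hsum : Tendsto (fun u : ℝ => ∑ l ∈ Finset.Icc 1 κ, (logSub (q l) ⟨u, y⟩).im) atBot
      (𝓝 (∑ _l ∈ Finset.Icc 1 κ, Real.pi)) :=
    tendsto_finsetSum _ fun l _ => tendsto_logSub_im_atBot hy
  rw [Finset.sum_const, Nat.card_Icc, Nat.add_sub_cancel, nsmul_eq_mul] at hsum
  filter_upwards [hsum.eventually_const_lt (sub_lt_comm.1 hc)] with u hu
  have harg := Complex.arg_neg_iff.2 (Regular.im_neg (x := ⟨u, y⟩) hκ hq (Or.inl hy))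
  rw [logPotential_im]
  linarith

theorem exists_logPotential_im_eq (hκ : 2 ≤ κ) (hq : StrictAntiOn q (Set.Icc 1 κ)) {y c : ℝ}
    (hy : 0 < y) (hc : c ∈ Set.Ioo (Real.pi - κ * Real.pi) 0) :
    ∃ u : ℝ, (logPotential κ q ⟨u, y⟩).im = c := by
  have hcont : Continuous fun u : ℝ => (logPotential κ q ⟨u, y⟩).im :=
    continuous_iff_continuousAt.2 fun u =>
      (Regular.continuousAt_logPotential_im_mk hκ hq (Or.inl hy)).comp
        (f := fun u : ℝ => (u, y)) (by fun_prop)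
  obtain ⟨u, hu⟩ := (eventually_lt_logPotential_im_atTop (κ := κ) (q := q) hy hc.2).exists
  obtain ⟨v, hv⟩ := (eventually_logPotential_im_lt_atBot hκ hq hy hc.1).exists
  exact mem_range_of_exists_le_of_exists_ge hcont ⟨v, hv.le⟩ ⟨u, hu.le⟩

theorem logPotential_im_of_re_eq_zero (hκ : 2 ≤ κ) (hq : StrictAntiOn q (Set.Icc 1 κ)) {j : ℕ}
    (hlo : 1 ≤ j) (hhi : j < κ) {p : ℝ} (hp : InCell κ q j p) (h0 : (potential κ q p).re = 0) :
    (logPotential κ q p).im = levelArg j := by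
  have hcell : InCell κ q j (p : ℂ).re := by rwa [Complex.ofReal_re]
  have hreg : Regular κ q p := Or.inr ⟨Complex.ofReal_im p, j, hlo, hhi, hcell⟩
  have hsum := sum_logSub_im_of_inCell (fun _ => 1) (Complex.ofReal_im p) hcell hhi.le
  have harg : Complex.arg (rootProd κ q p * potential κ q p) = -(Real.pi / 2) := by
    refine Complex.arg_eq_neg_pi_div_two_iff.2 ⟨?_, hreg.im_neg hκ hq⟩
    rw [rootProd_ofReal, Complex.re_ofReal_mul, h0, mul_zero]
  simp only [one_mul, Finset.sum_const, Nat.card_Icc, Nat.add_sub_cancel, nsmul_eq_mul,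
    mul_one] at hsum
  rw [logPotential_im, hsum, harg, levelArg]
  ring

theorem Regular.potential_eq_of_level (hκ : 2 ≤ κ) (hq : StrictAntiOn q (Set.Icc 1 κ)) {j : ℕ}
    {x : ℂ} (hx : Regular κ q x) (h : (logPotential κ q x).im = levelArg j) :
    potential κ q x = ‖potential κ q x‖ * (Complex.I * (-1) ^ j) := by
  rw [← hx.exp_logPotential hκ hq, Complex.norm_exp, ← exp_levelArg_mul_I, ← h,
    Complex.ofReal_exp, ← Complex.exp_add, Complex.re_add_im]

theorem Regular.of_mem_segment {x y z : ℂ} (hx : Regular κ q x) (hy : 0 < y.im)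
    (hz : z ∈ segment ℝ x y) : Regular κ q z := by
  obtain ⟨a, b, ha, hb, hab, rfl⟩ := hz
  rcases hb.eq_or_lt with rfl | hb
  · rw [add_zero] at hab
    simpa [hab] using hx
  · refine Or.inl ?_
    rw [Complex.add_im, Complex.smul_im, Complex.smul_im, smul_eq_mul, smul_eq_mul]
    exact add_pos_of_nonneg_of_pos (mul_nonneg ha hx.im_nonneg) (mul_pos hb hy)

theorem norm_potential_lt (hκ : 2 ≤ κ) (hq : StrictAntiOn q (Set.Icc 1 κ)) {x y : ℂ}
    (hx : Regular κ q x) (hxy : x.im < y.im)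
    (h : (logPotential κ q x).im = (logPotential κ q y).im) :
    ‖potential κ q y‖ < ‖potential κ q x‖ := by
  have hy : 0 < y.im := hx.im_nonneg.trans_lt hxy
  have hpos := im_logPotential_sub_div_pos hκ hq (fun e => hxy.ne (congrArg Complex.im e))
    fun z hz => hx.of_mem_segment hy hz
  have hreal : logPotential κ q y - logPotential κ q x
      = (((logPotential κ q y).re - (logPotential κ q x).re : ℝ) : ℂ) := by
    apply Complex.ext <;> simp [h]
  rw [hreal, div_eq_mul_inv, Complex.im_ofReal_mul, Complex.inv_im, Complex.sub_im] at hpos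
  have hinv : -(y.im - x.im) / Complex.normSq (y - x) ≤ 0 :=
    div_nonpos_of_nonpos_of_nonneg (by linarith) (Complex.normSq_nonneg _)
  rw [← hx.exp_logPotential hκ hq, ← Regular.exp_logPotential hκ hq (Or.inl hy),
    Complex.norm_exp, Complex.norm_exp, Real.exp_lt_exp]
  exact sub_neg.1 (neg_of_mul_pos_left hpos hinv)

theorem continuousWithinAt_level {c : ℝ} {w : ℝ → ℝ} {y₀ : ℝ} (hκ : 2 ≤ κ)
    (hq : StrictAntiOn q (Set.Icc 1 κ)) (hy₀ : 0 ≤ y₀) (hreg : Regular κ q ⟨w y₀, y₀⟩)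
    (hw : ∀ y, 0 ≤ y → (logPotential κ q ⟨w y, y⟩).im = c) :
    ContinuousWithinAt w (Set.Ici 0) y₀ := by
  obtain ⟨l, r, hlr, hnear⟩ := mem_nhds_iff_exists_Ioo_subset.1 hreg.eventually_horizontal
  have hw₀ := hw y₀ hy₀
  have hlocal : ∀ u ∈ Set.Ioo l r,
      ContinuousWithinAt (fun y => (logPotential κ q ⟨u, y⟩).im) (Set.Ici 0) y₀ := fun u hu =>
    ((Regular.continuousAt_logPotential_im_mk hκ hq (hnear hu)).comp (f := fun y : ℝ => (u, y))
      (by fun_prop)).continuousWithinAt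
  have hlower : ∀ᶠ u in 𝓝[<] w y₀, (logPotential κ q ⟨u, y₀⟩).im < c := by
    filter_upwards [Ioo_mem_nhdsLT hlr.1] with u hu
    exact hw₀ ▸ logPotential_im_lt hκ hq hu.2 fun t ht =>
      hnear ⟨hu.1.trans_le ht.1, ht.2.trans_lt hlr.2⟩
  have hupper : ∀ᶠ u in 𝓝[>] w y₀, c < (logPotential κ q ⟨u, y₀⟩).im := by
    filter_upwards [Ioo_mem_nhdsGT hlr.2] with u hu
    exact hw₀ ▸ logPotential_im_lt hκ hq hu.1 fun t ht =>
      hnear ⟨hlr.1.trans_le ht.1, ht.2.trans_lt hu.2⟩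
  have hmono : ∀ᶠ y in 𝓝[Set.Ici 0] y₀,
      y ≠ y₀ → StrictMono fun u => (logPotential κ q ⟨u, y⟩).im := by
    rcases hy₀.eq_or_lt with rfl | hpos
    · filter_upwards [self_mem_nhdsWithin] with y hy hne
      exact strictMono_logPotential_im hκ hq (lt_of_le_of_ne hy hne.symm)
    · filter_upwards [nhdsWithin_le_nhds (eventually_gt_nhds hpos)] with y hy _
      exact strictMono_logPotential_im hκ hq hy
  exact continuousWithinAt_of_level (Φ := fun u y => (logPotential κ q ⟨u, y⟩).im) hw
    hmono hlower hupper (eventually_of_mem (Ioo_mem_nhds hlr.1 hlr.2) hlocal)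

end LevelCurve

/-! ### Behaviour at infinity -/

/-- The neighbourhoods of infinity in the open upper half plane. -/
def upperInfinity : Filter ℂ := Bornology.cobounded ℂ ⊓ 𝓟 {x | 0 < x.im}

theorem eventually_upperInfinity_im_pos : ∀ᶠ x in upperInfinity, 0 < x.im :=
  mem_inf_of_right (mem_principal_self _)

theorem ne_zero_of_im_pos {x : ℂ} (h : 0 < x.im) : x ≠ 0 := fun h0 => by simp [h0] at h

theorem tendsto_div_cobounded (t : ℂ) :
    Tendsto (fun x : ℂ => t / x) (Bornology.cobounded ℂ) (𝓝 0) := by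
  simpa [div_eq_mul_inv] using (tendsto_inv₀_cobounded (α := ℂ)).const_mul t

theorem tendsto_log_one_add_div (t : ℂ) :
    Tendsto (fun x : ℂ => Complex.log (1 + t / x)) (Bornology.cobounded ℂ) (𝓝 0) := by
  have hquot : Tendsto (fun x : ℂ => 1 + t / x) (Bornology.cobounded ℂ) (𝓝 1) := by
    simpa using (tendsto_div_cobounded t).const_add 1
  simpa using hquot.clog Complex.one_mem_slitPlane

theorem tendsto_pow_mul_log_sub_logTaylor (n : ℕ) (t : ℂ) :
    Tendsto (fun x : ℂ => x ^ n * (Complex.log (1 + t / x) - Complex.logTaylor (n + 1) (t / x)))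
      (Bornology.cobounded ℂ) (𝓝 0) := by
  refine ((Asymptotics.isBigO_refl (fun x : ℂ => x ^ n) _).mul
    ((Complex.log_sub_logTaylor_isBigO n).comp_tendsto (tendsto_div_cobounded t))).trans_tendsto ?_
  refine (tendsto_div_cobounded (t ^ (n + 1))).congr' ?_
  filter_upwards [Bornology.eventually_ne_cobounded (0 : ℂ)] with x hx
  simp only [Function.comp, div_pow]
  field_simp
  ring

theorem log_neg_div {z x : ℂ} (hz : z.im < 0) (hx : 0 < x.im) :
    Complex.log (-z / x) = Complex.log z + Real.pi * Complex.I - Complex.log x := by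
  have hz0 : z ≠ 0 := fun h0 => by simp [h0] at hz
  have hexp : -z / x
      = Complex.exp (Complex.log z + Real.pi * Complex.I - Complex.log x) := by
    rw [Complex.exp_sub, Complex.exp_add, Complex.exp_log hz0, Complex.exp_pi_mul_I,
      Complex.exp_log (ne_zero_of_im_pos hx), mul_neg_one]
  have him : (Complex.log z + Real.pi * Complex.I - Complex.log x).im
      = z.arg + Real.pi - x.arg := by simp [Complex.log_im]
  have hz1 := Complex.neg_pi_lt_arg z
  have hz2 := Complex.arg_neg_iff.2 hz
  have hx1 := Complex.arg_le_pi x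
  have hx2 := Complex.arg_nonneg_iff.2 hx.le
  rw [hexp, Complex.log_exp]
  · rw [him]; linarith
  · rw [him]; linarith

theorem logSub_zero_eq_log {x : ℂ} (h : 0 < x.im) : logSub 0 x = Complex.log x := by
  have hne : x - (0 : ℝ) ≠ 0 := sub_ofReal_ne_zero (Or.inl h)
  conv_rhs => rw [← sub_zero x, ← Complex.ofReal_zero, ← exp_logSub hne]
  rw [Complex.log_exp]
  · linarith [logSub_im_pos (t := 0) h, Real.pi_pos]
  · exact (logSub_im_lt_pi h).le

theorem logSub_eq_add {t : ℝ} {x : ℂ} (h : 0 < x.im) :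
    logSub t x = Complex.log x + Complex.log (1 + -t / x) := by
  have hx := ne_zero_of_im_pos h
  have hexp : 1 + -t / x = Complex.exp (logSub t x - logSub 0 x) := by
    rw [Complex.exp_sub, exp_logSub (sub_ofReal_ne_zero (Or.inl h)),
      exp_logSub (sub_ofReal_ne_zero (Or.inl h)), Complex.ofReal_zero, sub_zero]
    field_simp
    ring
  have ht1 := logSub_im_pos (t := t) h
  have ht2 := logSub_im_lt_pi (t := t) h
  have h01 := logSub_im_pos (t := 0) h
  have h02 := logSub_im_lt_pi (t := 0) h
  rw [hexp, Complex.log_exp, ← logSub_zero_eq_log h]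
  · ring
  · rw [Complex.sub_im]; linarith
  · rw [Complex.sub_im]; linarith

section Infinity

variable {κ : ℕ} {q : ℕ → ℝ}

theorem sum_residueAt_mul_pow (hq : StrictAntiOn q (Set.Icc 1 κ)) {n : ℕ} (hn : n < κ) :
    ∑ l ∈ Finset.Icc 1 κ, (residueAt κ q l : ℂ) * (q l : ℂ) ^ n
      = if n = κ - 1 then -1 else 0 := by
  have h := sum_residueAt_mul_eval hq (P := X ^ n)
    ((degree_X_pow n).trans_lt (WithBot.coe_lt_coe.2 hn))
  simp only [eval_pow, eval_X, coeff_X_pow] at h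
  rw [h]
  simp only [eq_comm, neg_ite, neg_zero]

theorem sum_ofReal_residueAt (hκ : 2 ≤ κ) (hq : StrictAntiOn q (Set.Icc 1 κ)) :
    ∑ l ∈ Finset.Icc 1 κ, (residueAt κ q l : ℂ) = 0 := by
  exact_mod_cast residueSum_self hκ hq

theorem tendsto_sum_residueAt_mul_log :
    Tendsto (fun x : ℂ =>
      ∑ l ∈ Finset.Icc 1 κ, (residueAt κ q l : ℂ) * Complex.log (1 + -q l / x))
      (Bornology.cobounded ℂ) (𝓝 0) := by
  simpa only [mul_zero, Finset.sum_const_zero] using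
    tendsto_finsetSum (Finset.Icc 1 κ) fun l _ =>
      (tendsto_log_one_add_div (-q l : ℂ)).const_mul (residueAt κ q l : ℂ)

theorem potential_eq_sum_log (hκ : 2 ≤ κ) (hq : StrictAntiOn q (Set.Icc 1 κ)) {x : ℂ}
    (h : 0 < x.im) : potential κ q x
      = ∑ l ∈ Finset.Icc 1 κ, (residueAt κ q l : ℂ) * Complex.log (1 + -q l / x) := by
  simp_rw [potential, logSub_eq_add h, mul_add]
  rw [Finset.sum_add_distrib, ← Finset.sum_mul, sum_ofReal_residueAt hκ hq, zero_mul, zero_add]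

theorem tendsto_potential_zero (hκ : 2 ≤ κ) (hq : StrictAntiOn q (Set.Icc 1 κ)) :
    Tendsto (potential κ q) upperInfinity (𝓝 0) :=
  (tendsto_sum_residueAt_mul_log.mono_left inf_le_left).congr' <|
    eventually_upperInfinity_im_pos.mono fun _ hx => (potential_eq_sum_log hκ hq hx).symm

theorem tendsto_potential_re_cobounded (hκ : 2 ≤ κ) (hq : StrictAntiOn q (Set.Icc 1 κ)) :
    Tendsto (fun x => (potential κ q x).re) (Bornology.cobounded ℂ) (𝓝 0) := by
  refine ((Complex.continuous_re.tendsto 0).comp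
    (tendsto_sum_residueAt_mul_log (κ := κ) (q := q))).congr' ?_
  have hroots : ∀ᶠ x in Bornology.cobounded ℂ, ∀ l ∈ Finset.Icc 1 κ, x ≠ (q l : ℂ) :=
    (eventually_all_finset _).2 fun l _ => Bornology.eventually_ne_cobounded _
  filter_upwards [Bornology.eventually_ne_cobounded (0 : ℂ), hroots] with x hx hxq
  have hterm : ∀ l ∈ Finset.Icc 1 κ,
      ((residueAt κ q l : ℂ) * Complex.log (1 + -q l / x)).re
        = residueAt κ q l * Real.log ‖x - q l‖ - residueAt κ q l * Real.log ‖x‖ := by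
    intro l hl
    have hquot : 1 + -q l / x = (x - q l) / x := by field_simp; ring
    rw [Complex.re_ofReal_mul, Complex.log_re, hquot, norm_div,
      Real.log_div (norm_ne_zero_iff.2 (sub_ne_zero.2 (hxq l hl))) (norm_ne_zero_iff.2 hx), mul_sub]
  rw [Function.comp, Complex.re_sum, Finset.sum_congr rfl hterm, Finset.sum_sub_distrib,
    ← Finset.sum_mul, ← residueSum, residueSum_self hκ hq, zero_mul, sub_zero, potential_re]

theorem sum_residueAt_mul_logTaylor (hκ : 1 ≤ κ) (hq : StrictAntiOn q (Set.Icc 1 κ)) (x : ℂ) :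
    ∑ l ∈ Finset.Icc 1 κ, (residueAt κ q l : ℂ) * Complex.logTaylor κ (-q l / x)
      = 1 / ((κ - 1 : ℕ) * x ^ (κ - 1)) := by
  have hmoment : ∀ n ∈ Finset.range κ, ∑ l ∈ Finset.Icc 1 κ,
      (residueAt κ q l : ℂ) * ((-1) ^ (n + 1) * (-q l / x) ^ n / n)
      = if n = κ - 1 then 1 / ((κ - 1 : ℕ) * x ^ (κ - 1)) else 0 := by
    intro n hn
    have hsign : (-1 : ℂ) ^ n * (-1) ^ n = 1 := by rw [← mul_pow]; simp
    calc ∑ l ∈ Finset.Icc 1 κ, (residueAt κ q l : ℂ) * ((-1) ^ (n + 1) * (-q l / x) ^ n / n)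
        = -(1 / (n * x ^ n)) * ∑ l ∈ Finset.Icc 1 κ, (residueAt κ q l : ℂ) * (q l : ℂ) ^ n := by
          rw [Finset.mul_sum]
          refine Finset.sum_congr rfl fun l _ => ?_
          rw [div_pow, neg_pow (q l : ℂ), pow_succ]
          linear_combination (-(residueAt κ q l : ℂ) * (q l : ℂ) ^ n / (x ^ n * n)) * hsign
      _ = if n = κ - 1 then 1 / ((κ - 1 : ℕ) * x ^ (κ - 1)) else 0 := by
          rw [sum_residueAt_mul_pow hq (Finset.mem_range.1 hn)]
          split_ifs with h
          · rw [h]; ring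
          · rw [mul_zero]
  simp_rw [Complex.logTaylor, Finset.mul_sum]
  rw [Finset.sum_comm, Finset.sum_congr rfl hmoment, Finset.sum_ite_eq',
    if_pos (Finset.mem_range.2 (Nat.sub_one_lt_of_lt hκ))]

theorem tendsto_pow_mul_potential (hκ : 2 ≤ κ) (hq : StrictAntiOn q (Set.Icc 1 κ)) :
    Tendsto (fun x => x ^ (κ - 1) * potential κ q x) upperInfinity
      (𝓝 (1 / (κ - 1 : ℕ))) := by
  have hremainder : Tendsto (fun x : ℂ => ∑ l ∈ Finset.Icc 1 κ, (residueAt κ q l : ℂ) *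
      (x ^ (κ - 1) * (Complex.log (1 + -q l / x) - Complex.logTaylor κ (-q l / x))))
      upperInfinity (𝓝 (∑ l ∈ Finset.Icc 1 κ, (residueAt κ q l : ℂ) * 0)) :=
    tendsto_finsetSum _ fun l _ => by
      have h := tendsto_pow_mul_log_sub_logTaylor (κ - 1) (-q l)
      rw [Nat.sub_add_cancel (one_le_two.trans hκ)] at h
      exact (h.mono_left inf_le_left).const_mul _
  simp only [mul_zero, Finset.sum_const_zero] at hremainder
  have hlim := hremainder.add_const (1 / ((κ - 1 : ℕ) : ℂ))
  rw [zero_add] at hlim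
  refine hlim.congr' ?_
  filter_upwards [eventually_upperInfinity_im_pos] with x hx
  have hmain : 1 / ((κ - 1 : ℕ) : ℂ) = x ^ (κ - 1) * (1 / ((κ - 1 : ℕ) * x ^ (κ - 1))) := by
    have := pow_ne_zero (κ - 1) (ne_zero_of_im_pos hx)
    field_simp
  rw [hmain, ← sum_residueAt_mul_logTaylor (one_le_two.trans hκ) hq x,
    potential_eq_sum_log hκ hq hx, Finset.mul_sum, Finset.mul_sum, ← Finset.sum_add_distrib]
  exact Finset.sum_congr rfl fun l _ => by ring

theorem tendsto_rootProd_div :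
    Tendsto (fun x => rootProd κ q x / x ^ κ) (Bornology.cobounded ℂ) (𝓝 (-1)) := by
  have hprod : Tendsto (fun x : ℂ => -∏ l ∈ Finset.Icc 1 κ, (1 + -q l / x))
      (Bornology.cobounded ℂ) (𝓝 (-∏ l ∈ Finset.Icc 1 κ, (1 + 0))) :=
    (tendsto_finsetProd _ fun l _ => (tendsto_div_cobounded (-q l)).const_add 1).neg
  simp only [add_zero, Finset.prod_const_one] at hprod
  refine hprod.congr' ?_
  filter_upwards [Bornology.eventually_ne_cobounded (0 : ℂ)] with x hx
  have hpow : x ^ κ = ∏ _l ∈ Finset.Icc 1 κ, x := by simp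
  rw [rootProd, neg_div, hpow, ← Finset.prod_div_distrib]
  congr 1
  refine Finset.prod_congr rfl fun l _ => ?_
  field_simp
  ring

theorem tendsto_neg_rootProd_mul_potential_div (hκ : 2 ≤ κ) (hq : StrictAntiOn q (Set.Icc 1 κ)) :
    Tendsto (fun x => -(rootProd κ q x * potential κ q x) / x) upperInfinity
      (𝓝 (1 / (κ - 1 : ℕ))) := by
  have hlim := (tendsto_rootProd_div (κ := κ) (q := q)).mono_left inf_le_left |>.neg.mul
    (tendsto_pow_mul_potential hκ hq)
  rw [neg_neg, one_mul] at hlim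
  refine hlim.congr' ?_
  filter_upwards [eventually_upperInfinity_im_pos] with x hx
  have hx0 := ne_zero_of_im_pos hx
  obtain ⟨n, rfl⟩ := Nat.exists_eq_add_of_le' (one_le_two.trans hκ)
  rw [Nat.add_sub_cancel]
  field_simp
  ring

theorem sum_logSub_im_of_im_pos {x : ℂ} (hx : 0 < x.im) :
    ∑ l ∈ Finset.Icc 1 κ, (logSub (q l) x).im
      = κ * x.arg + ∑ l ∈ Finset.Icc 1 κ, (Complex.log (1 + -q l / x)).im := by
  simp_rw [logSub_eq_add hx, Complex.add_im]
  rw [Finset.sum_add_distrib, Finset.sum_const, Nat.card_Icc, Nat.add_sub_cancel, nsmul_eq_mul,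
    Complex.log_im x]

theorem tendsto_logPotential_im_add (hκ : 2 ≤ κ) (hq : StrictAntiOn q (Set.Icc 1 κ)) :
    Tendsto (fun x => (logPotential κ q x).im + ((κ : ℝ) - 1) * x.arg) upperInfinity (𝓝 0) := by
  have hfactors : Tendsto (fun x : ℂ => ∑ l ∈ Finset.Icc 1 κ, (Complex.log (1 + -q l / x)).im)
      upperInfinity (𝓝 (∑ _l ∈ Finset.Icc 1 κ, (0 : ℂ).im)) :=
    tendsto_finsetSum _ fun l _ => (Complex.continuous_im.tendsto _).comp
      ((tendsto_log_one_add_div (-q l)).mono_left inf_le_left)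
  have hpos : (0 : ℝ) < 1 / (κ - 1 : ℕ) :=
    one_div_pos.2 (Nat.cast_pos.2 (Nat.sub_pos_of_lt hκ))
  have hlog := tendsto_neg_rootProd_mul_potential_div hκ hq
  rw [show (1 / (κ - 1 : ℕ) : ℂ) = ((1 / (κ - 1 : ℕ) : ℝ) : ℂ) by push_cast; rfl] at hlog
  have hlogim := ((Complex.continuous_im.tendsto _).comp
    (hlog.clog (Complex.ofReal_mem_slitPlane.2 hpos))).sub hfactors
  rw [Complex.log_im, Complex.arg_ofReal_of_nonneg hpos.le] at hlogim
  simp only [Complex.zero_im, Finset.sum_const_zero, sub_zero] at hlogim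
  refine hlogim.congr' ?_
  filter_upwards [eventually_upperInfinity_im_pos] with x hx
  rw [Function.comp, log_neg_div (Regular.im_neg hκ hq (Or.inl hx)) hx, logPotential_im,
    sum_logSub_im_of_im_pos hx, Complex.sub_im, Complex.add_im, Complex.log_im,
    Complex.log_im x, Complex.im_ofReal_mul, Complex.I_im]
  ring

end Infinity

/-! ### The Poincaré hemisphere -/

theorem tendsto_inv_sqrt_one_add_sq :
    Tendsto (fun r : ℝ => (√(1 + r ^ 2))⁻¹) atTop (𝓝 0) :=
  (Real.tendsto_sqrt_atTop.comp
    (tendsto_atTop_add_const_left _ 1 (tendsto_pow_atTop two_ne_zero))).inv_tendsto_atTop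

theorem tendsto_inv_sqrt_one_add_sq_mul :
    Tendsto (fun r : ℝ => (√(1 + r ^ 2))⁻¹ * r) atTop (𝓝 1) := by
  have hlim : Tendsto (fun r : ℝ => √(1 - (√(1 + r ^ 2))⁻¹ ^ 2)) atTop (𝓝 √(1 - 0 ^ 2)) :=
    (Real.continuous_sqrt.tendsto _).comp ((tendsto_inv_sqrt_one_add_sq.pow 2).const_sub 1)
  rw [zero_pow two_ne_zero, sub_zero, Real.sqrt_one] at hlim
  refine hlim.congr' ?_
  filter_upwards [eventually_ge_atTop 0] with r hr
  have hpos : 0 < 1 + r ^ 2 := by positivity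
  have hsq : 1 - (1 + r ^ 2)⁻¹ = r ^ 2 / (1 + r ^ 2) := by field_simp; ring
  rw [inv_pow, Real.sq_sqrt hpos.le, hsq, Real.sqrt_div' _ hpos.le, Real.sqrt_sq hr,
    div_eq_inv_mul]

theorem tendsto_poincareEmbedding {α : Type*} {f : Filter α} {X : α → ℂ} {θ : ℝ}
    (hnorm : Tendsto (fun s => ‖X s‖) f atTop) (harg : Tendsto (fun s => (X s).arg) f (𝓝 θ)) :
    Tendsto (fun s => poincareEmbedding (X s)) f (𝓝 (Complex.exp (Complex.I * θ), 0)) := by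
  refine Tendsto.prodMk_nhds ?_ (tendsto_inv_sqrt_one_add_sq.comp hnorm)
  have hpolar : Tendsto (fun s => (((√(1 + ‖X s‖ ^ 2))⁻¹ * ‖X s‖ : ℝ) : ℂ) *
      Complex.exp (Complex.I * ((X s).arg : ℝ))) f (𝓝 ((1 : ℝ) * Complex.exp (Complex.I * θ))) := by
    have hexp : Continuous fun t : ℝ => Complex.exp (Complex.I * t) := by fun_prop
    exact ((Complex.continuous_ofReal.tendsto _).comp
      (tendsto_inv_sqrt_one_add_sq_mul.comp hnorm)).mul ((hexp.tendsto θ).comp harg)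
  rw [Complex.ofReal_one, one_mul] at hpolar
  refine hpolar.congr fun s => ?_
  rw [mul_comm Complex.I, Complex.ofReal_mul, mul_assoc, Complex.norm_mul_exp_arg_mul_I]

theorem tendsto_norm_atTop_of_poincareEmbedding {α : Type*} {f : Filter α} {X : α → ℂ} {u : ℂ}
    (h : Tendsto (fun s => poincareEmbedding (X s)) f (𝓝 (u, 0))) :
    Tendsto (fun s => ‖X s‖) f atTop := by
  have hzero : Tendsto (fun s => (√(1 + ‖X s‖ ^ 2))⁻¹) f (𝓝 0) :=
    (continuous_snd.tendsto (u, (0 : ℝ))).comp h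
  have hpos : Tendsto (fun s => (√(1 + ‖X s‖ ^ 2))⁻¹) f (𝓝[>] 0) :=
    tendsto_nhdsWithin_iff.2 ⟨hzero, Eventually.of_forall fun s =>
      inv_pos.2 (Real.sqrt_pos.2 (by positivity))⟩
  have hsqrt : Tendsto (fun s => √(1 + ‖X s‖ ^ 2) - 1) f atTop :=
    tendsto_atTop_add_const_right _ _
      ((tendsto_inv_nhdsGT_zero.comp hpos).congr fun s => inv_inv _)
  refine tendsto_atTop_mono (fun s => ?_) hsqrt
  rw [sub_le_iff_le_add, Real.sqrt_le_left (by positivity)]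
  nlinarith [norm_nonneg (X s)]

theorem tendsto_poincareEmbedding_conj {α : Type*} {f : Filter α} {X : α → ℂ} {u : ℂ}
    (h : Tendsto (fun s => poincareEmbedding (X s)) f (𝓝 (u, 0))) :
    Tendsto (fun s => poincareEmbedding (starRingEnd ℂ (X s))) f
      (𝓝 (starRingEnd ℂ u, 0)) := by
  have hconj : Continuous fun p : ℂ × ℝ => (starRingEnd ℂ p.1, p.2) := by fun_prop
  refine ((hconj.tendsto _).comp h).congr fun s => ?_
  simp [poincareEmbedding]

/-! ### Forward solutions -/

/-- The filter of times increasing to the end `ω` of the interval `[0, ω)`. -/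
def endFilter (ω : EReal) : Filter ℝ := comap (fun s : ℝ => (s : EReal)) (𝓝[<] ω)

theorem endFilter_coe (T : ℝ) : endFilter (T : EReal) = 𝓝[<] T := by
  rw [endFilter, nhdsWithin, comap_inf, comap_principal, ← EReal.isEmbedding_coe.nhds_eq_comap,
    nhdsWithin]
  congr 2
  ext s
  simp

theorem endFilter_neBot {ω : EReal} (h : 0 < ω) : (endFilter ω).NeBot := by
  refine comap_neBot fun t ht => ?_
  obtain ⟨a, ha, hat⟩ := (mem_nhdsLT_iff_exists_Ioo_subset' h).1 ht
  obtain ⟨r, har, hrω⟩ := EReal.lt_iff_exists_real_btwn.1 ha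
  exact ⟨r, hat ⟨har, hrω⟩⟩

theorem forwardInterval_coe (T : ℝ) : forwardInterval (T : EReal) = Set.Ico 0 T := by
  ext s; simp [forwardInterval]

theorem Icc_subset_forwardInterval {ω : EReal} {s : ℝ} (hs : s ∈ forwardInterval ω) :
    Set.Icc 0 s ⊆ forwardInterval ω := fun _ ht =>
  ⟨ht.1, (EReal.coe_le_coe_iff.2 ht.2).trans_lt hs.2⟩

theorem forwardInterval_mem_nhdsGE {ω : EReal} {s : ℝ} (hs : s ∈ forwardInterval ω) :
    forwardInterval ω ∈ 𝓝[≥] s := by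
  obtain ⟨r, hsr, hrω⟩ := EReal.lt_iff_exists_real_btwn.1 hs.2
  filter_upwards [Ico_mem_nhdsGE (EReal.coe_lt_coe_iff.1 hsr)] with t ht
  exact ⟨hs.1.trans ht.1, (EReal.coe_lt_coe_iff.2 ht.2).trans hrω⟩

theorem eventually_endFilter {ω : EReal} {s : ℝ} (hs : s ∈ forwardInterval ω) :
    ∀ᶠ t in endFilter ω, s < t ∧ t ∈ forwardInterval ω := by
  have hbetween : (fun t : ℝ => (t : EReal)) ⁻¹' Set.Ioo s ω ∈ endFilter ω :=
    preimage_mem_comap (Ioo_mem_nhdsLT hs.2)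
  filter_upwards [hbetween] with t ht
  have hst : s < t := EReal.coe_lt_coe_iff.1 ht.1
  exact ⟨hst, hs.1.trans hst.le, ht.2⟩

theorem eqOn_Icc_of_contDiff {E : Type*} [NormedAddCommGroup E] [NormedSpace ℝ E] {f : E → E}
    (hf : ContDiff ℝ 1 f) {x y : ℝ → E} {a b : ℝ}
    (hxc : ContinuousOn x (Set.Icc a b)) (hyc : ContinuousOn y (Set.Icc a b))
    (hx : ∀ t ∈ Set.Ico a b, HasDerivWithinAt x (f (x t)) (Set.Ici t) t)
    (hy : ∀ t ∈ Set.Ico a b, HasDerivWithinAt y (f (y t)) (Set.Ici t) t) (h : x a = y a) :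
    Set.EqOn x y (Set.Icc a b) := by
  obtain ⟨K, hK⟩ := hf.locallyLipschitz.locallyLipschitzOn.exists_lipschitzOnWith_of_compact
    ((isCompact_Icc.image_of_continuousOn hxc).union (isCompact_Icc.image_of_continuousOn hyc))
  exact ODE_solution_unique_of_mem_Icc_right (v := fun _ => f)
    (s := fun _ => x '' Set.Icc a b ∪ y '' Set.Icc a b) (fun _ _ => hK)
    hxc hx (fun t ht => Or.inl ⟨t, Set.Ico_subset_Icc_self ht, rfl⟩)
    hyc hy (fun t ht => Or.inr ⟨t, Set.Ico_subset_Icc_self ht, rfl⟩) h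

namespace IsForwardSolution

variable {f : ℂ → ℂ} {z : ℂ} {ω ω' : EReal} {x y : ℝ → ℂ}

theorem zero_mem (hx : IsForwardSolution f z ω x) : (0 : ℝ) ∈ forwardInterval ω :=
  ⟨le_rfl, hx.pos⟩

theorem continuousOn (hx : IsForwardSolution f z ω x) : ContinuousOn x (forwardInterval ω) :=
  fun s hs => (hx.deriv s hs).continuousWithinAt

theorem hasDerivWithinAt_Ici (hx : IsForwardSolution f z ω x) {s : ℝ}
    (hs : s ∈ forwardInterval ω) : HasDerivWithinAt x (f (x s)) (Set.Ici s) s :=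
  (hx.deriv s hs).mono_of_mem_nhdsWithin (forwardInterval_mem_nhdsGE hs)

theorem eq_of_mem (hf : ContDiff ℝ 1 f) (hx : IsForwardSolution f z ω x)
    (hy : IsForwardSolution f z ω' y) {s : ℝ} (hs : s ∈ forwardInterval ω)
    (hs' : s ∈ forwardInterval ω') : x s = y s := by
  have hsub := Icc_subset_forwardInterval hs
  have hsub' := Icc_subset_forwardInterval hs'
  exact eqOn_Icc_of_contDiff hf (hx.continuousOn.mono hsub) (hy.continuousOn.mono hsub')
    (fun t ht => hx.hasDerivWithinAt_Ici (hsub (Set.Ico_subset_Icc_self ht)))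
    (fun t ht => hy.hasDerivWithinAt_Ici (hsub' (Set.Ico_subset_Icc_self ht)))
    (hx.init.trans hy.init.symm) ⟨hs.1, le_rfl⟩

theorem ne_zero_of_blowup (hf : ContDiff ℝ 1 f) (hx : IsForwardSolution f z ω x)
    (hinf : Tendsto (fun s => ‖x s‖) (endFilter ω) atTop) {s : ℝ}
    (hs : s ∈ forwardInterval ω) : f (x s) ≠ 0 := by
  intro hzero
  have := endFilter_neBot hx.pos
  obtain ⟨t, hnorm, hst, ht⟩ :=
    ((hinf.eventually_gt_atTop ‖x s‖).and (eventually_endFilter hs)).exists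
  have hsub : Set.Icc s t ⊆ forwardInterval ω :=
    (Set.Icc_subset_Icc_left hs.1).trans (Icc_subset_forwardInterval ht)
  have hconst : Set.EqOn x (fun _ => x s) (Set.Icc s t) :=
    eqOn_Icc_of_contDiff hf (hx.continuousOn.mono hsub) continuousOn_const
      (fun r hr => hx.hasDerivWithinAt_Ici (hsub (Set.Ico_subset_Icc_self hr)))
      (fun r _ => by simpa only [hzero] using hasDerivWithinAt_const r (Set.Ici r) (x s)) rfl
  rw [hconst ⟨hst.le, le_rfl⟩] at hnorm
  exact hnorm.false

theorem le_of_blowup (hf : ContDiff ℝ 1 f) (hx : IsForwardSolution f z ω x)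
    (hy : IsForwardSolution f z ω' y)
    (hinf : Tendsto (fun s => ‖x s‖) (endFilter ω) atTop) : ω' ≤ ω := by
  by_contra! hlt
  obtain ⟨r, hωr, hrω'⟩ := EReal.lt_iff_exists_real_btwn.1 hlt
  have hr : r ∈ forwardInterval ω' := ⟨(EReal.coe_pos.1 (hx.pos.trans hωr)).le, hrω'⟩
  obtain ⟨C, hC⟩ := isCompact_Icc.exists_bound_of_continuousOn
    (hy.continuousOn.mono (Icc_subset_forwardInterval hr))
  have := endFilter_neBot hx.pos
  obtain ⟨t, hnorm, -, ht⟩ :=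
    ((hinf.eventually_gt_atTop C).and (eventually_endFilter hx.zero_mem)).exists
  have htr : t ∈ Set.Icc 0 r := ⟨ht.1, (EReal.coe_lt_coe_iff.1 (ht.2.trans hωr)).le⟩
  rw [hx.eq_of_mem hf hy ht (Icc_subset_forwardInterval hr htr)] at hnorm
  exact hnorm.not_ge (hC t htr)

theorem limit_unique (hf : ContDiff ℝ 1 f) (hx : IsForwardSolution f z ω x)
    (hy : IsForwardSolution f z ω' y) {u v : ℂ}
    (hxu : Tendsto (fun s => poincareEmbedding (x s)) (endFilter ω) (𝓝 (u, 0)))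
    (hyv : Tendsto (fun s => poincareEmbedding (y s)) (endFilter ω') (𝓝 (v, 0))) : u = v := by
  obtain rfl : ω = ω' := le_antisymm
    (hy.le_of_blowup hf hx (tendsto_norm_atTop_of_poincareEmbedding hyv))
    (hx.le_of_blowup hf hy (tendsto_norm_atTop_of_poincareEmbedding hxu))
  have := endFilter_neBot hx.pos
  have hyu := hxu.congr' ((eventually_endFilter hx.zero_mem).mono fun s hs =>
    congrArg poincareEmbedding (hx.eq_of_mem hf hy hs.2 hs.2))
  exact congrArg Prod.fst (tendsto_nhds_unique hyu hyv)

theorem eq_of_hasDerivWithinAt_zero (hx : IsForwardSolution f z ω x) {g : ℂ → ℝ}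
    (hg : ∀ s ∈ forwardInterval ω, HasDerivWithinAt (fun t => g (x t)) 0 (forwardInterval ω) s)
    {s : ℝ} (hs : s ∈ forwardInterval ω) : g (x s) = g z := by
  have hsub := Icc_subset_forwardInterval hs
  have hsub' := Set.Ico_subset_Icc_self.trans hsub
  rw [← hx.init]
  exact constant_of_has_deriv_right_zero (f := fun t => g (x t))
    (fun t ht => (hg t (hsub ht)).continuousWithinAt.mono hsub)
    (fun t ht => (hg t (hsub' ht)).mono_of_mem_nhdsWithin
      (forwardInterval_mem_nhdsGE (hsub' ht))) s ⟨hs.1, le_rfl⟩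

end IsForwardSolution

theorem isForwardSolution_coe {f : ℂ → ℂ} {z : ℂ} {T : ℝ} {x : ℝ → ℂ} (hT : 0 < T)
    (h0 : x 0 = z) (hx : ∀ s ∈ Set.Ico 0 T, HasDerivWithinAt x (f (x s)) (Set.Ico 0 T) s) :
    IsForwardSolution f z (T : EReal) x :=
  ⟨EReal.coe_pos.2 hT, h0, by rwa [forwardInterval_coe]⟩

/-! ### The separatrices -/

section StrictMono

variable {α β : Type*} [LinearOrder α] [Preorder β] [TopologicalSpace β] {f : α → β} {a : α} {b : β}

theorem lt_of_strictMonoOn_Ici [NoMaxOrder α] [ClosedIciTopology β]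
    (hf : StrictMonoOn f (Set.Ici a)) (hlim : Tendsto f atTop (𝓝 b)) : f a < b := by
  obtain ⟨c, hac⟩ := exists_gt a
  have : Nonempty α := ⟨a⟩
  refine (hf Set.self_mem_Ici hac.le hac).trans_le (ge_of_tendsto hlim ?_)
  filter_upwards [eventually_ge_atTop c] with r hr
  exact hf.monotoneOn hac.le (hac.le.trans hr) hr

theorem lt_of_strictAntiOn_Ici [NoMaxOrder α] [ClosedIicTopology β]
    (hf : StrictAntiOn f (Set.Ici a)) (hlim : Tendsto f atTop (𝓝 b)) : b < f a :=
  lt_of_strictMonoOn_Ici (β := βᵒᵈ) hf.dual_right hlim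

theorem lt_of_strictAntiOn_Iic [NoMinOrder α] [ClosedIciTopology β]
    (hf : StrictAntiOn f (Set.Iic a)) (hlim : Tendsto f atBot (𝓝 b)) : f a < b :=
  lt_of_strictMonoOn_Ici (α := αᵒᵈ) hf.dual_left hlim

end StrictMono

section Inverse

variable {S : ℝ → ℝ} {a T : ℝ}

theorem image_Ici_eq_Ico (hmono : StrictMonoOn S (Set.Ici a)) (hcont : ContinuousOn S (Set.Ici a))
    (hlim : Tendsto S atTop (𝓝 T)) : S '' Set.Ici a = Set.Ico (S a) T := by
  have hlt : ∀ y ∈ Set.Ici a, S y < T := fun y hy =>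
    lt_of_strictMonoOn_Ici (hmono.mono (Set.Ici_subset_Ici.2 hy)) hlim
  refine Set.Subset.antisymm ?_ fun s hs => ?_
  · rintro _ ⟨y, hy, rfl⟩
    exact ⟨hmono.monotoneOn Set.self_mem_Ici hy hy, hlt y hy⟩
  · obtain ⟨b, hb, hab⟩ :=
      ((hlim.eventually (eventually_gt_nhds hs.2)).and (eventually_ge_atTop a)).exists
    obtain ⟨y, hy, hys⟩ :=
      intermediate_value_Icc hab (hcont.mono Set.Icc_subset_Ici_self) ⟨hs.1, hb.le⟩
    exact ⟨y, hy.1, hys⟩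

theorem exists_continuousOn_inverse (hmono : StrictMonoOn S (Set.Ici a))
    (hcont : ContinuousOn S (Set.Ici a)) (hlim : Tendsto S atTop (𝓝 T)) :
    ∃ Y : ℝ → ℝ, ContinuousOn Y (Set.Ico (S a) T) ∧
      (∀ s ∈ Set.Ico (S a) T, a ≤ Y s ∧ S (Y s) = s) ∧ Tendsto Y (𝓝[<] T) atTop := by
  have himage := image_Ici_eq_Ico hmono hcont hlim
  let e : Set.Ici a ≃o Set.Ico (S a) T :=
    (hmono.orderIso S (Set.Ici a)).trans (OrderIso.setCongr _ _ himage)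
  have he : ∀ s, S (e.symm s) = s := fun s => congrArg Subtype.val (e.apply_symm_apply s)
  let Y : ℝ → ℝ := fun s => if h : s ∈ Set.Ico (S a) T then e.symm ⟨s, h⟩ else a
  have hYe : ∀ s : Set.Ico (S a) T, Y s = e.symm s := fun s => dif_pos s.2
  have hY : ∀ s ∈ Set.Ico (S a) T, a ≤ Y s ∧ S (Y s) = s := fun s hs => by
    rw [hYe ⟨s, hs⟩]
    exact ⟨(e.symm ⟨s, hs⟩).2, he ⟨s, hs⟩⟩
  refine ⟨Y, ?_, hY, tendsto_atTop.2 fun M => ?_⟩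
  · rw [continuousOn_iff_continuous_domRestrict]
    exact (continuous_subtype_val.comp e.symm.continuous).congr fun s => (hYe s).symm
  · have hM : max M a ∈ Set.Ici a := le_max_right M a
    have hSM : S (max M a) ∈ Set.Ico (S a) T := himage ▸ Set.mem_image_of_mem S hM
    filter_upwards [Ioo_mem_nhdsLT hSM.2] with s hs
    obtain ⟨hYs, hSY⟩ := hY s ⟨hSM.1.trans hs.1.le, hs.2⟩
    rw [← hSY] at hs
    exact (le_max_left M a).trans ((hmono.lt_iff_lt hM hYs).1 hs.1).le

end Inverse

/-- The direction of the `j`-th saddle at infinity. -/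
def saddleAngle (κ j : ℕ) : ℝ :=
  Real.pi / ((κ : ℝ) - 1) * ((j : ℝ) - 1) + Real.pi / (2 * ((κ : ℝ) - 1))

/-- The field `x ↦ i Q(x)` with time reversed for even `j`, so that in both parities the `j`-th
separatrix runs into its saddle in forward time. -/
def signedField (κ : ℕ) (q : ℕ → ℝ) (j : ℕ) (x : ℂ) : ℂ :=
  -(-1) ^ j * (Complex.I * rootProd κ q x)

/-- The time at which the `j`-th separatrix, started on the real axis, reaches infinity. -/
def blowupTime (κ : ℕ) (q : ℕ → ℝ) (j : ℕ) : ℝ := (-1) ^ j * residueSum κ q j * Real.pi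

/-- The curve `y ↦ w y + i y`, `y ≥ 0`, is the part in the closed upper half plane of the level
curve through the real point `p` on which the argument of the potential is `levelArg j`. -/
structure IsLevelCurve (κ : ℕ) (q : ℕ → ℝ) (j : ℕ) (p : ℝ) (w : ℝ → ℝ) : Prop where
  zero : w 0 = p
  continuousOn : ContinuousOn w (Set.Ici 0)
  regular : ∀ y, 0 ≤ y → Regular κ q ⟨w y, y⟩
  im_eq : ∀ y, 0 ≤ y → (logPotential κ q ⟨w y, y⟩).im = levelArg j

theorem tendsto_mk_upperInfinity (w : ℝ → ℝ) :
    Tendsto (fun y : ℝ => (⟨w y, y⟩ : ℂ)) atTop upperInfinity := by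
  refine tendsto_inf.2 ⟨tendsto_norm_atTop_iff_cobounded.1 ?_,
    tendsto_principal.2 (eventually_gt_atTop 0)⟩
  exact tendsto_atTop_mono (fun y => (le_abs_self y).trans (Complex.abs_im_le_norm ⟨w y, y⟩))
    tendsto_id

section Trajectory

variable {κ : ℕ} {q : ℕ → ℝ} {j : ℕ} {p : ℝ}

theorem saddleAngle_eq_div (hκ : 2 ≤ κ) (j : ℕ) :
    saddleAngle κ j = -levelArg j / ((κ : ℝ) - 1) := by
  have hk : (κ : ℝ) - 1 ≠ 0 := (sub_pos.2 (Nat.one_lt_cast.2 hκ)).ne'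
  rw [saddleAngle, levelArg]
  field_simp
  ring

theorem equatorSaddle_eq (κ j : ℕ) :
    equatorSaddle κ j = (Complex.exp (Complex.I * saddleAngle κ j), 0) := rfl

theorem blowupTime_pos (hq : StrictAntiOn q (Set.Icc 1 κ)) (hlo : 1 ≤ j) (hhi : j < κ) :
    0 < blowupTime κ q j :=
  mul_pos (residueSum_pos hq hlo hhi) Real.pi_pos

theorem norm_potential_of_re_eq_zero (hq : StrictAntiOn q (Set.Icc 1 κ)) (hlo : 1 ≤ j)
    (hhi : j < κ) (hp : InCell κ q j p) (h0 : (potential κ q p).re = 0) :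
    ‖potential κ q p‖ = blowupTime κ q j := by
  rw [← Complex.abs_im_eq_norm.2 h0,
    potential_im_of_inCell (Complex.ofReal_im p) (by rwa [Complex.ofReal_re]) hhi.le,
    ← abs_of_pos (blowupTime_pos hq hlo hhi), blowupTime, mul_assoc, abs_mul ((-1) ^ j),
    abs_neg_one_pow, one_mul, mul_comm]

theorem exists_levelCurve (hκ : 2 ≤ κ) (hq : StrictAntiOn q (Set.Icc 1 κ)) (hlo : 1 ≤ j)
    (hhi : j < κ) (hp : InCell κ q j p) (h0 : (potential κ q p).re = 0) :
    ∃ w, IsLevelCurve κ q j p w := by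
  choose! u hu using fun y (hy : 0 < y) => exists_logPotential_im_eq hκ hq hy
    ⟨pi_sub_mul_pi_lt_levelArg hhi, levelArg_neg hlo⟩
  let w : ℝ → ℝ := fun y => if 0 < y then u y else p
  have hw0 : w 0 = p := if_neg (lt_irrefl _)
  have hreg : ∀ y, 0 ≤ y → Regular κ q ⟨w y, y⟩ := fun y hy => by
    rcases hy.eq_or_lt with rfl | hy
    · exact Or.inr ⟨rfl, j, hlo, hhi, hw0.symm ▸ hp⟩
    · exact Or.inl hy
  have hlevel : ∀ y, 0 ≤ y → (logPotential κ q ⟨w y, y⟩).im = levelArg j := fun y hy => by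
    rcases hy.eq_or_lt with rfl | hy
    · rw [hw0]
      exact logPotential_im_of_re_eq_zero hκ hq hlo hhi hp h0
    · rw [show w y = u y from if_pos hy]
      exact hu y hy
  exact ⟨w, hw0, fun y hy => continuousWithinAt_level hκ hq hy (hreg y hy) hlevel, hreg, hlevel⟩

namespace IsLevelCurve

variable {w : ℝ → ℝ}

theorem mk_zero (hw : IsLevelCurve κ q j p w) : (⟨w 0, 0⟩ : ℂ) = p := by
  rw [hw.zero]; rfl

theorem continuousOn_mk (hw : IsLevelCurve κ q j p w) :
    ContinuousOn (fun y : ℝ => (⟨w y, y⟩ : ℂ)) (Set.Ici 0) :=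
  continuous_complex_mk.comp_continuousOn (hw.continuousOn.prodMk continuousOn_id)

theorem continuousOn_potential (hκ : 2 ≤ κ) (hq : StrictAntiOn q (Set.Icc 1 κ))
    (hw : IsLevelCurve κ q j p w) :
    ContinuousOn (fun y : ℝ => potential κ q ⟨w y, y⟩) (Set.Ici 0) := fun y hy =>
  (hasDerivAt_potential (one_le_two.trans hκ) hq
    (hw.regular y hy).offCuts).continuousAt.comp_continuousWithinAt
    (f := fun y : ℝ => (⟨w y, y⟩ : ℂ)) (hw.continuousOn_mk y hy)

theorem strictAntiOn_norm_potential (hκ : 2 ≤ κ) (hq : StrictAntiOn q (Set.Icc 1 κ))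
    (hw : IsLevelCurve κ q j p w) :
    StrictAntiOn (fun y : ℝ => ‖potential κ q ⟨w y, y⟩‖) (Set.Ici 0) :=
  fun y₁ hy₁ y₂ hy₂ hlt => norm_potential_lt hκ hq (hw.regular y₁ hy₁) hlt
    ((hw.im_eq y₁ hy₁).trans (hw.im_eq y₂ hy₂).symm)

theorem tendsto_arg (hκ : 2 ≤ κ) (hq : StrictAntiOn q (Set.Icc 1 κ))
    (hw : IsLevelCurve κ q j p w) :
    Tendsto (fun y : ℝ => Complex.arg ⟨w y, y⟩) atTop (𝓝 (saddleAngle κ j)) := by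
  have hk : (κ : ℝ) - 1 ≠ 0 := (sub_pos.2 (Nat.one_lt_cast.2 hκ)).ne'
  have hlim := (((tendsto_logPotential_im_add hκ hq).comp
    (tendsto_mk_upperInfinity w)).sub_const (levelArg j)).div_const ((κ : ℝ) - 1)
  rw [zero_sub, ← saddleAngle_eq_div hκ] at hlim
  refine hlim.congr' ?_
  filter_upwards [eventually_ge_atTop 0] with y hy
  simp only [Function.comp, hw.im_eq y hy]
  field_simp
  ring

theorem exists_parametrization (hκ : 2 ≤ κ) (hq : StrictAntiOn q (Set.Icc 1 κ)) {T : ℝ}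
    (hw : IsLevelCurve κ q j p w) (hT : ‖potential κ q p‖ = T) :
    ∃ Y : ℝ → ℝ, ContinuousOn Y (Set.Ico 0 T) ∧
      (∀ s ∈ Set.Ico 0 T, 0 ≤ Y s ∧ T - ‖potential κ q ⟨w (Y s), Y s⟩‖ = s) ∧
      Tendsto Y (𝓝[<] T) atTop := by
  have hlim := ((tendsto_potential_zero hκ hq).comp (tendsto_mk_upperInfinity w)).norm.const_sub T
  rw [norm_zero, sub_zero] at hlim
  have hinv := exists_continuousOn_inverse (a := 0)
    (S := fun y : ℝ => T - ‖potential κ q ⟨w y, y⟩‖)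
    (fun y₁ hy₁ y₂ hy₂ hlt =>
      sub_lt_sub_left (hw.strictAntiOn_norm_potential hκ hq hy₁ hy₂ hlt) T)
    (continuousOn_const.sub (hw.continuousOn_potential hκ hq).norm) hlim
  simpa only [hw.mk_zero, hT, sub_self] using hinv

end IsLevelCurve

theorem OffCuts.eventually {x : ℂ} (h : OffCuts κ q x) : ∀ᶠ y in 𝓝 x, OffCuts κ q y :=
  (eventually_all_finset _).2 fun l hl => (h l hl).elim
    (fun h => (Complex.continuous_im.continuousAt.eventually (eventually_gt_nhds h)).mono
      fun _ => Or.inl)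
    fun h => (Complex.continuous_re.continuousAt.eventually_ne h).mono fun _ => Or.inr

theorem hasStrictDerivAt_potential (hκ : 1 ≤ κ) (hq : StrictAntiOn q (Set.Icc 1 κ)) {x : ℂ}
    (h : OffCuts κ q x) : HasStrictDerivAt (potential κ q) (1 / rootProd κ q x) x := by
  have han : AnalyticAt ℂ (potential κ q) x :=
    Complex.analyticAt_iff_eventually_differentiableAt.2
      (h.eventually.mono fun _ hy => (hasDerivAt_potential hκ hq hy).differentiableAt)
  exact (hasDerivAt_potential hκ hq h).deriv ▸ han.hasStrictDerivAt

theorem hasDerivWithinAt_of_comp_eq {f : ℂ → ℂ} {f' φ' : ℂ} {X φ : ℝ → ℂ} {J : Set ℝ} {s : ℝ}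
    (hf : HasStrictDerivAt f f' (X s)) (hf' : f' ≠ 0) (hX : ContinuousWithinAt X J s)
    (hs : s ∈ J) (heq : ∀ t ∈ J, f (X t) = φ t) (hφ : HasDerivAt φ φ' s) :
    HasDerivWithinAt X (f'⁻¹ * φ') J s := by
  have hinv := (hf.to_localInverse hf').hasDerivAt
  have hleft := hf.eventually_left_inverse hf'
  rw [heq s hs] at hinv
  refine ((hinv.comp_of_eq s hφ rfl).hasDerivWithinAt (s := J)).congr_of_eventuallyEq_of_mem ?_ hs
  filter_upwards [hX.eventually hleft, self_mem_nhdsWithin] with t ht htJ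
  rw [Function.comp, ← heq t htJ, ht]

theorem hasDerivWithinAt_of_potential_eq (hκ : 1 ≤ κ) (hq : StrictAntiOn q (Set.Icc 1 κ))
    {X : ℝ → ℂ} {J : Set ℝ} {s T : ℝ} (hX : ContinuousWithinAt X J s) (hs : s ∈ J)
    (hoff : OffCuts κ q (X s))
    (heq : ∀ t ∈ J, potential κ q (X t) = (T - t : ℝ) * (Complex.I * (-1) ^ j)) :
    HasDerivWithinAt X (signedField κ q j (X s)) J s := by
  have hφ : HasDerivAt (fun t : ℝ => ((T - t : ℝ) : ℂ) * (Complex.I * (-1) ^ j))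
      (((-1 : ℝ) : ℂ) * (Complex.I * (-1) ^ j)) s :=
    ((hasDerivAt_id s).const_sub T).ofReal_comp.mul_const _
  refine (hasDerivWithinAt_of_comp_eq (hasStrictDerivAt_potential hκ hq hoff)
    (one_div_ne_zero hoff.rootProd_ne_zero) hX hs heq hφ).congr_deriv ?_
  rw [signedField, one_div, inv_inv]
  push_cast
  ring

theorem exists_forwardSolution (hκ : 2 ≤ κ) (hq : StrictAntiOn q (Set.Icc 1 κ)) (hlo : 1 ≤ j)
    (hhi : j < κ) (hp : InCell κ q j p) (h0 : (potential κ q p).re = 0) :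
    ∃ X, IsForwardSolution (signedField κ q j) p (blowupTime κ q j) X ∧
      Tendsto (fun s => poincareEmbedding (X s)) (endFilter (blowupTime κ q j))
        (𝓝 (equatorSaddle κ j)) := by
  obtain ⟨w, hw⟩ := exists_levelCurve hκ hq hlo hhi hp h0
  set T := blowupTime κ q j
  have hT : 0 < T := blowupTime_pos hq hlo hhi
  obtain ⟨Y, hYc, hY, hYlim⟩ :=
    hw.exists_parametrization hκ hq (norm_potential_of_re_eq_zero hq hlo hhi hp h0)
  have hY0 : Y 0 = 0 := by
    obtain ⟨hnonneg, hnorm⟩ := hY 0 ⟨le_rfl, hT⟩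
    refine (hw.strictAntiOn_norm_potential hκ hq).injOn hnonneg Set.self_mem_Ici ?_
    simp only [hw.mk_zero, norm_potential_of_re_eq_zero hq hlo hhi hp h0]
    linarith
  have hinf : Tendsto (fun s => (⟨w (Y s), Y s⟩ : ℂ)) (𝓝[<] T) (Bornology.cobounded ℂ) :=
    ((tendsto_mk_upperInfinity w).comp hYlim).mono_right inf_le_left
  refine ⟨fun s => ⟨w (Y s), Y s⟩, isForwardSolution_coe hT ?_ fun s hs => ?_, ?_⟩
  · simp only [hY0, hw.mk_zero]
  · refine hasDerivWithinAt_of_potential_eq (T := T) (one_le_two.trans hκ) hq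
      (hw.continuousOn_mk.comp hYc (fun s hs => (hY s hs).1) s hs) hs
      (hw.regular _ (hY s hs).1).offCuts fun t ht => ?_
    obtain ⟨hnonneg, hnorm⟩ := hY t ht
    rw [(hw.regular _ hnonneg).potential_eq_of_level hκ hq (hw.im_eq _ hnonneg),
      ← sub_eq_of_eq_add' (sub_eq_iff_eq_add.1 hnorm)]
  · rw [endFilter_coe, equatorSaddle_eq]
    exact tendsto_poincareEmbedding (tendsto_norm_atTop_iff_cobounded.2 hinf)
      ((hw.tendsto_arg hκ hq).comp hYlim)

end Trajectory

/-! ### Real points of the stable manifolds -/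

theorem hasDerivWithinAt_log_norm_sub {x : ℝ → ℂ} {x' a : ℂ} {J : Set ℝ} {s : ℝ}
    (hx : HasDerivWithinAt x x' J s) (ha : x s - a ≠ 0) :
    HasDerivWithinAt (fun t => Real.log ‖x t - a‖) (x' / (x s - a)).re J s := by
  have hlog := ((hx.sub_const a).norm_sq.log (pow_ne_zero 2 (norm_ne_zero_iff.2 ha))).div_const 2
  simp only [Real.log_pow, Nat.cast_ofNat, mul_div_cancel_left₀ _ (two_ne_zero' ℝ)] at hlog
  refine hlog.congr_deriv ?_
  rw [mul_div_assoc, mul_div_cancel_left₀ _ (two_ne_zero' ℝ), Complex.inner, Complex.sq_norm,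
    Complex.div_re, Complex.mul_re, Complex.conj_re, Complex.conj_im]
  ring

section Converse

variable {κ : ℕ} {q : ℕ → ℝ} {j m : ℕ}

theorem contDiff_signedField (j : ℕ) : ContDiff ℝ 1 (signedField κ q j) := by
  unfold signedField rootProd
  fun_prop

theorem rootProd_ne_zero_of_signedField {x : ℂ} (h : signedField κ q j x ≠ 0) :
    rootProd κ q x ≠ 0 :=
  right_ne_zero_of_mul (right_ne_zero_of_mul h)

theorem rootProd_conj (x : ℂ) :
    rootProd κ q (starRingEnd ℂ x) = starRingEnd ℂ (rootProd κ q x) := by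
  simp [rootProd, map_prod]

theorem IsForwardSolution.conj (hjm : (-1 : ℂ) ^ j = -(-1) ^ m) {z : ℂ} {ω : EReal}
    {x : ℝ → ℂ} (hx : IsForwardSolution (signedField κ q m) z ω x) :
    IsForwardSolution (signedField κ q j) (starRingEnd ℂ z) ω (fun s => starRingEnd ℂ (x s)) := by
  refine ⟨hx.pos, by rw [hx.init], fun s hs => (hx.deriv s hs).star.congr_deriv ?_⟩
  simp only [signedField, ← starRingEnd_apply, map_mul, map_neg, map_pow, map_one, Complex.conj_I,
    rootProd_conj, hjm]
  ring

theorem hasDerivWithinAt_potential_re (hκ : 1 ≤ κ) (hq : StrictAntiOn q (Set.Icc 1 κ))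
    {x : ℝ → ℂ} {x' : ℂ} {J : Set ℝ} {s : ℝ} (hx : HasDerivWithinAt x x' J s)
    (hne : rootProd κ q (x s) ≠ 0) :
    HasDerivWithinAt (fun t => (potential κ q (x t)).re) (x' / rootProd κ q (x s)).re J s := by
  rw [rootProd_ne_zero_iff] at hne
  simp only [potential_re]
  refine (HasDerivWithinAt.fun_sum fun l hl =>
    (hasDerivWithinAt_log_norm_sub hx (hne l hl)).const_mul (residueAt κ q l)).congr_deriv ?_
  rw [div_eq_mul_one_div x', ← sum_residueAt_div hκ hq hne, Finset.mul_sum, Complex.re_sum]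
  refine Finset.sum_congr rfl fun l _ => ?_
  rw [← Complex.re_ofReal_mul, div_eq_mul_one_div x', mul_left_comm]

theorem IsForwardSolution.potential_re_eq (hκ : 1 ≤ κ) (hq : StrictAntiOn q (Set.Icc 1 κ))
    {z : ℂ} {ω : EReal} {x : ℝ → ℂ} (hx : IsForwardSolution (signedField κ q j) z ω x)
    (hinf : Tendsto (fun s => ‖x s‖) (endFilter ω) atTop) {s : ℝ} (hs : s ∈ forwardInterval ω) :
    (potential κ q (x s)).re = (potential κ q z).re := by
  refine hx.eq_of_hasDerivWithinAt_zero (g := fun w => (potential κ q w).re) (fun t ht => ?_) hs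
  have hne := rootProd_ne_zero_of_signedField
    (hx.ne_zero_of_blowup (contDiff_signedField j) hinf ht)
  refine (hasDerivWithinAt_potential_re hκ hq (hx.deriv t ht) hne).congr_deriv ?_
  rw [signedField, mul_div_assoc, mul_div_cancel_right₀ _ hne]
  rcases neg_one_pow_eq_or ℂ j with hj | hj <;> simp [hj]

theorem IsForwardSolution.potential_re_eq_zero_of_blowup (hκ : 2 ≤ κ)
    (hq : StrictAntiOn q (Set.Icc 1 κ)) {z : ℂ} {ω : EReal} {x : ℝ → ℂ}
    (hx : IsForwardSolution (signedField κ q j) z ω x)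
    (hinf : Tendsto (fun s => ‖x s‖) (endFilter ω) atTop) : (potential κ q z).re = 0 := by
  have := endFilter_neBot hx.pos
  have hzero : Tendsto (fun s => (potential κ q (x s)).re) (endFilter ω) (𝓝 0) :=
    (tendsto_potential_re_cobounded hκ hq).comp (tendsto_norm_atTop_iff_cobounded.1 hinf)
  exact tendsto_nhds_unique tendsto_const_nhds (hzero.congr'
    ((eventually_endFilter hx.zero_mem).mono fun s hs =>
      hx.potential_re_eq (one_le_two.trans hκ) hq hinf hs.2))

theorem exists_inCell (hq : StrictAntiOn q (Set.Icc 1 κ)) {t : ℝ}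
    (ht : ∀ l ∈ Finset.Icc 1 κ, t ≠ q l) : ∃ m ≤ κ, InCell κ q m t := by
  classical
  let P : ℕ → Prop := fun l => l = 0 ∨ t < q l
  have hspec : P (Nat.findGreatest P κ) := Nat.findGreatest_spec (Nat.zero_le κ) (Or.inl rfl)
  refine ⟨Nat.findGreatest P κ, Nat.findGreatest_le κ, fun l hl => ?_⟩
  obtain ⟨hl1, hlκ⟩ := Finset.mem_Icc.1 hl
  refine ⟨fun hle => ?_, fun hgt => ?_⟩
  · have hpos : 1 ≤ Nat.findGreatest P κ := hl1.trans hle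
    exact (hspec.resolve_left (Nat.one_le_iff_ne_zero.1 hpos)).trans_le
      (hq.antitoneOn ⟨hl1, hlκ⟩ ⟨hpos, Nat.findGreatest_le κ⟩ hle)
  · have hnot := Nat.findGreatest_is_greatest hgt hlκ
    exact (not_lt.1 fun h => hnot (Or.inr h)).lt_of_ne (ht l hl).symm

theorem ordConnected_setOf_inCell : Set.OrdConnected {t | InCell κ q m t} :=
  ⟨fun _ ha _ hb _ ht l hl => ⟨fun h => ht.2.trans_lt ((hb l hl).1 h),
    fun h => ((ha l hl).2 h).trans_le ht.1⟩⟩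

theorem strictAntiOn_potential_re (hκ : 1 ≤ κ) (hq : StrictAntiOn q (Set.Icc 1 κ))
    (hm : m ≤ κ) :
    StrictAntiOn (fun t : ℝ => (-1) ^ m * (potential κ q t).re) {t | InCell κ q m t} := by
  have hderiv : ∀ t, InCell κ q m t → HasDerivAt (fun t : ℝ => (-1) ^ m * (potential κ q t).re)
      (-((-1) ^ m * ∏ l ∈ Finset.Icc 1 κ, (t - q l))⁻¹) t := fun t ht => by
    have hoff : OffCuts κ q t := fun l hl => Or.inr (ht.ne hl)
    refine ((hasDerivAt_potential hκ hq hoff).real_of_complex.const_mul _).congr_deriv ?_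
    rw [rootProd_ofReal, ← Complex.ofReal_one, ← Complex.ofReal_div, Complex.ofReal_re, one_div,
      inv_neg, mul_neg, mul_inv, ← inv_pow, inv_neg_one]
  refine strictAntiOn_of_deriv_neg ordConnected_setOf_inCell.convex
    (fun t ht => (hderiv t ht).continuousAt.continuousWithinAt) fun t ht => ?_
  have ht' : InCell κ q m t := interior_subset ht
  rw [(hderiv t ht').deriv]
  exact neg_neg_of_pos (inv_pos.2 (ht'.prod_sub_pos le_rfl le_rfl hm))

theorem InCell.ne_zero_of_potential_re_eq_zero (hκ : 2 ≤ κ) (hq : StrictAntiOn q (Set.Icc 1 κ))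
    {t : ℝ} (ht : InCell κ q m t) (h0 : (potential κ q t).re = 0) : m ≠ 0 := by
  rintro rfl
  have hsub : Set.Ici t ⊆ {r | InCell κ q 0 r} := fun r hr l hl =>
    ⟨fun h => absurd (Finset.mem_Icc.1 hl).1 (by omega), fun h => ((ht l hl).2 h).trans_le hr⟩
  have hlim := ((tendsto_potential_re_cobounded hκ hq).comp
    (RCLike.tendsto_ofReal_atTop_cobounded ℂ)).const_mul ((-1) ^ 0)
  have hpos := lt_of_strictAntiOn_Ici
    ((strictAntiOn_potential_re (one_le_two.trans hκ) hq κ.zero_le).mono hsub) hlim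
  rw [h0] at hpos
  exact hpos.false

theorem InCell.ne_card_of_potential_re_eq_zero (hκ : 2 ≤ κ) (hq : StrictAntiOn q (Set.Icc 1 κ))
    {t : ℝ} (ht : InCell κ q m t) (h0 : (potential κ q t).re = 0) : m ≠ κ := by
  rintro rfl
  have hsub : Set.Iic t ⊆ {r | InCell m q m r} := fun r hr l hl =>
    ⟨fun h => (Set.mem_Iic.1 hr).trans_lt ((ht l hl).1 h),
      fun h => absurd (Finset.mem_Icc.1 hl).2 h.not_ge⟩
  have hlim := ((tendsto_potential_re_cobounded hκ hq).comp
    (RCLike.tendsto_ofReal_atBot_cobounded ℂ)).const_mul ((-1) ^ m)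
  have hneg := lt_of_strictAntiOn_Iic
    ((strictAntiOn_potential_re (one_le_two.trans hκ) hq le_rfl).mono hsub) hlim
  rw [h0] at hneg
  exact hneg.false

theorem saddleAngle_mem_Ioo (hlo : 1 ≤ j) (hhi : j < κ) :
    saddleAngle κ j ∈ Set.Ioo 0 Real.pi := by
  have hj : (1 : ℝ) ≤ j := Nat.one_le_cast.2 hlo
  have hjκ : (j : ℝ) + 1 ≤ κ := by exact_mod_cast hhi
  have hk : (0 : ℝ) < κ - 1 := by linarith
  have hangle : saddleAngle κ j = Real.pi * ((j - 1 / 2) / (κ - 1)) := by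
    rw [saddleAngle]; field_simp; ring
  rw [hangle]
  exact ⟨mul_pos Real.pi_pos (div_pos (by linarith) hk),
    mul_lt_of_lt_one_right Real.pi_pos ((div_lt_one hk).2 (by linarith))⟩

theorem saddleAngle_injective (hκ : 2 ≤ κ) : Function.Injective (saddleAngle κ) := fun i j h => by
  have hk : (0 : ℝ) < κ - 1 := sub_pos.2 (Nat.one_lt_cast.2 hκ)
  exact Nat.cast_injective (sub_left_injective
    (mul_left_cancel₀ (div_pos Real.pi_pos hk).ne' (add_right_cancel h)))

theorem eq_of_exp_saddleAngle_eq (hj1 : 1 ≤ j) (hj2 : j < κ) (hm1 : 1 ≤ m) (hm2 : m < κ)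
    (h : Complex.exp (Complex.I * saddleAngle κ j) = Complex.exp (Complex.I * saddleAngle κ m)) :
    j = m := by
  rw [mul_comm, mul_comm Complex.I] at h
  have hcos := congrArg Complex.re h
  rw [Complex.exp_ofReal_mul_I_re, Complex.exp_ofReal_mul_I_re] at hcos
  exact saddleAngle_injective (by omega)
    (Real.injOn_cos (Set.Ioo_subset_Icc_self (saddleAngle_mem_Ioo hj1 hj2))
      (Set.Ioo_subset_Icc_self (saddleAngle_mem_Ioo hm1 hm2)) hcos)

theorem exp_saddleAngle_im_pos (hlo : 1 ≤ j) (hhi : j < κ) :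
    0 < (Complex.exp (Complex.I * saddleAngle κ j)).im := by
  rw [mul_comm, Complex.exp_ofReal_mul_I_im]
  exact Real.sin_pos_of_mem_Ioo (saddleAngle_mem_Ioo hlo hhi)

theorem eq_of_mem_stableManifold (hκ : 2 ≤ κ) (hq : StrictAntiOn q (Set.Icc 1 κ)) (hj1 : 1 ≤ j)
    (hj2 : j < κ) (hm1 : 1 ≤ m) (hm2 : m < κ) {t : ℝ} (ht : InCell κ q m t)
    (h0 : (potential κ q t).re = 0)
    (hmem : (t : ℂ) ∈ stableManifold (signedField κ q j) (equatorSaddle κ j)) : j = m := by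
  obtain ⟨ω, x, hx, hlim⟩ := hmem
  obtain ⟨X, hX, hXlim⟩ := exists_forwardSolution hκ hq hm1 hm2 ht h0
  rw [equatorSaddle_eq] at hlim hXlim
  have hsq : ((-1 : ℂ) ^ j) ^ 2 = ((-1) ^ m) ^ 2 := by
    rw [pow_right_comm, neg_one_sq, one_pow, pow_right_comm, neg_one_sq, one_pow]
  rcases eq_or_eq_neg_of_sq_eq_sq _ _ hsq with hsign | hsign
  · have hfield : signedField κ q m = signedField κ q j := by
      funext x
      rw [signedField, signedField, hsign]
    rw [hfield] at hX
    exact eq_of_exp_saddleAngle_eq hj1 hj2 hm1 hm2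
      (hx.limit_unique (contDiff_signedField j) hX hlim hXlim)
  -- With opposite signs the conjugate of `X` is the solution, and its limit is below the real axis.
  · have hX' := hX.conj hsign
    rw [Complex.conj_ofReal] at hX'
    have hconj := congrArg Complex.im (hx.limit_unique (contDiff_signedField j) hX' hlim
      (tendsto_poincareEmbedding_conj hXlim))
    rw [Complex.conj_im] at hconj
    linarith [exp_saddleAngle_im_pos hj1 hj2, exp_saddleAngle_im_pos hm1 hm2]

theorem ofReal_mem_stableManifold_iff (hκ : 2 ≤ κ) (hq : StrictAntiOn q (Set.Icc 1 κ))
    (hlo : 1 ≤ j) (hhi : j < κ) {t : ℝ} :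
    (t : ℂ) ∈ stableManifold (signedField κ q j) (equatorSaddle κ j) ↔
      InCell κ q j t ∧ (potential κ q t).re = 0 := by
  refine ⟨fun hmem => ?_, fun ⟨ht, h0⟩ => ⟨_, exists_forwardSolution hκ hq hlo hhi ht h0⟩⟩
  obtain ⟨ω, x, hx, hlim⟩ := id hmem
  have hinf := tendsto_norm_atTop_of_poincareEmbedding hlim
  have h0 := hx.potential_re_eq_zero_of_blowup hκ hq hinf
  have hne := rootProd_ne_zero_of_signedField
    (hx.ne_zero_of_blowup (contDiff_signedField j) hinf hx.zero_mem)
  rw [hx.init, rootProd_ne_zero_iff] at hne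
  obtain ⟨m, hmκ, ht⟩ := exists_inCell hq fun l hl h =>
    hne l hl (sub_eq_zero.2 (congrArg Complex.ofReal h))
  have hm1 := Nat.one_le_iff_ne_zero.2 (ht.ne_zero_of_potential_re_eq_zero hκ hq h0)
  have hm2 := hmκ.lt_of_ne (ht.ne_card_of_potential_re_eq_zero hκ hq h0)
  exact ⟨eq_of_mem_stableManifold hκ hq hlo hhi hm1 hm2 ht h0 hmem ▸ ht, h0⟩

end Converse

section PolyQ

variable {κ : ℕ} {a q : ℕ → ℝ} {j : ℕ} {p : ℝ}

theorem imagField_polyQ (hq : HasOrderedSimpleRoots κ (polyQ κ a) q) (x : ℂ) :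
    imagField (polyQ κ a) x = Complex.I * rootProd κ q x := by
  rw [imagField, polyQ_eq_neg_nodal hq, rootProd, Lagrange.nodal]
  simp [map_prod]

theorem signedField_of_odd (hq : HasOrderedSimpleRoots κ (polyQ κ a) q) (hj : Odd j) :
    signedField κ q j = imagField (polyQ κ a) := by
  funext x
  rw [signedField, hj.neg_one_pow, imagField_polyQ hq, neg_neg, one_mul]

theorem signedField_of_even (hq : HasOrderedSimpleRoots κ (polyQ κ a) q) (hj : Even j) :
    signedField κ q j = fun x => -imagField (polyQ κ a) x := by
  funext x
  rw [signedField, hj.neg_one_pow, imagField_polyQ hq, neg_one_mul]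

theorem trajH_eq_stableManifold (hq : HasOrderedSimpleRoots κ (polyQ κ a) q) (j : ℕ) :
    trajH κ (polyQ κ a) j = stableManifold (signedField κ q j) (equatorSaddle κ j) := by
  rw [trajH]
  split_ifs with hj
  · rw [signedField_of_odd hq hj]
  · rw [unstableManifold, signedField_of_even hq (Nat.not_odd_iff_even.1 hj)]

theorem trajH_inter_real (hκ : 2 ≤ κ) (hq : HasOrderedSimpleRoots κ (polyQ κ a) q) (hlo : 1 ≤ j)
    (hhi : j < κ) (hp : InCell κ q j p) (h0 : (potential κ q p).re = 0) :
    trajH κ (polyQ κ a) j ∩ {x : ℂ | x.im = 0} = {(p : ℂ)} := by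
  rw [trajH_eq_stableManifold hq]
  refine Set.eq_singleton_iff_unique_mem.2
    ⟨⟨(ofReal_mem_stableManifold_iff hκ hq.anti hlo hhi).2 ⟨hp, h0⟩, Complex.ofReal_im p⟩, ?_⟩
  rintro z ⟨hz, him⟩
  lift z to ℝ using him
  obtain ⟨hcell, hre⟩ := (ofReal_mem_stableManifold_iff hκ hq.anti hlo hhi).1 hz
  exact congrArg _ ((strictAntiOn_potential_re (one_le_two.trans hκ) hq.anti hhi.le).injOn hcell hp
    (by simp only [hre, h0]))

theorem isBlowupTime_blowupTime (hκ : 2 ≤ κ) (hq : HasOrderedSimpleRoots κ (polyQ κ a) q)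
    (hlo : 1 ≤ j) (hhi : j < κ) (hp : InCell κ q j p) (h0 : (potential κ q p).re = 0) :
    IsBlowupTime (imagField (polyQ κ a)) p (blowupTime κ q j) := by
  obtain ⟨X, hX, hlim⟩ := exists_forwardSolution hκ hq.anti hlo hhi hp h0
  have hinf := tendsto_norm_atTop_of_poincareEmbedding hlim
  rw [endFilter_coe] at hinf
  rcases j.even_or_odd with hj | hj
  -- For even `j` time is reversed; complex conjugation reverses it back.
  · have hX' := hX.conj (j := j + 1) (by rw [pow_succ, mul_neg_one])
    rw [Complex.conj_ofReal, signedField_of_odd hq hj.add_one] at hX'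
    exact ⟨_, hX', by simpa only [Complex.norm_conj] using hinf⟩
  · exact ⟨X, signedField_of_odd hq hj ▸ hX, hinf⟩

theorem residueSum_eq_blowupTime (κ : ℕ) (q : ℕ → ℝ) (j : ℕ) :
    residueSum κ q j = blowupTime κ q j * (-1) ^ j / Real.pi := by
  have hsign : (-1 : ℝ) ^ j * (-1) ^ j = 1 := by rw [← mul_pow, neg_one_mul, neg_neg, one_pow]
  rw [eq_div_iff Real.pi_ne_zero, blowupTime]
  linear_combination -(residueSum κ q j * Real.pi) * hsign

end PolyQ

end

theorem mainTheorem2 (κ : ℕ) (hκ : 2 ≤ κ) (a q : ℕ → ℝ)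
    (hq : HasOrderedSimpleRoots κ (polyQ κ a) q) :
    ∑ l ∈ Finset.Icc 1 κ, 1 / (polyQ κ a).derivative.eval (q l) = 0 ∧
    ∀ j ∈ Finset.Icc 1 (κ - 1),
      ∃ p T : ℝ, trajH κ (polyQ κ a) j ∩ {x : ℂ | x.im = 0} = {(p : ℂ)} ∧
        0 < T ∧ IsBlowupTime (imagField (polyQ κ a)) (p : ℂ) T ∧
        ∑ l ∈ Finset.Icc 1 j, 1 / (polyQ κ a).derivative.eval (q l)
          = T * (-1) ^ j / Real.pi := by
  refine ⟨(sum_one_div_derivative_polyQ hq le_rfl).trans (residueSum_self hκ hq.anti),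
    fun j hj => ?_⟩
  obtain ⟨hlo, hjκ⟩ := Finset.mem_Icc.1 hj
  have hhi : j < κ := by omega
  obtain ⟨p, hp, h0⟩ := exists_potential_re_eq_zero hq.anti hlo hhi
  have hcell := inCell_of_mem_Ioo hq.anti hlo hhi hp
  exact ⟨p, blowupTime κ q j, trajH_inter_real hκ hq hlo hhi hcell h0,
    blowupTime_pos hq.anti hlo hhi, isBlowupTime_blowupTime hκ hq hlo hhi hcell h0,
    (sum_one_div_derivative_polyQ hq hhi.le).trans (residueSum_eq_blowupTime κ q j)⟩
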